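/- **Notation.** For measurable $f:[0,1]\to\mathbb C$ let $f^*(t)=\inf\{\lambda\ge 0: |\{x\in[0,1]:|f(x)|>\lambda\}|\le t\}$, $t>0$, be its non-increasing rearrangement; for a sequence $b$ let $(b_n^*)_{n\ge1}$ be the non-increasing rearrangement of $(|b_k|)$. For $2<q\le\infty$ and $0<\tau\le\infty$ put $$\|f\|_{L_{2,q}}=\Big(\int_0^1\big(t^{1/2}f^*(t)\big)^q\frac{dt}{t}\Big)^{1/q},\qquad \|f\|_{L_{2,q,\tau}}=\Big(\sum_{k=1}^\infty\big(k^{1/q}\xi_k^*(f)\big)^{\tau}\frac1k\Big)^{1/\tau},$$ where $(\xi_k^*(f))_{k\ge1}$ is the non-increasing rearrangement of $\xi_m(f)=\big(\int_{2^{-m-1}}^{2^{-m}}f^*(t)^2\,dt\big)^{1/2}$, $m=0,1,2,\dots$, and for a complex sequence $a$ $$\|a\|_{\Lambda_{2,q,\tau}}=\Big(\sum_{k=1}^\infty\Big(k^{1/q}\sup_{s\ge k}\Big(\frac1s\sum_{m=1}^{2^s}(a_m^*)^2\Big)^{1/2}\Big)^{\tau}\frac1k\Big)^{1/\tau}.$$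 Here $s$ runs over integers, $1/\infty=0$, and for the outer exponent $q=\infty$ (in $L_{2,q}$ and in the $\ell^q$-sums below) or $\tau=\infty$ the expression $(\int g^q\,\frac{dt}t)^{1/q}$, $(\sum_k c_k^\tau\frac1k)^{1/\tau}$, etc. is replaced by the supremum of $g$, $c_k$. A function belongs to one of these spaces if it is measurable and its quasi-norm is finite. **Theorem.** Let $2<q\le\infty$ and $M<\infty$. (1) For every $0<\tau\le\infty$ there is a constant $C=C(q,\tau,M)$ such that for every orthonormal system $(\varphi_k)_{k\ge1}$ in $L_2([0,1])$ with $|\varphi_k|\le M$ almost everywhere for all $k$, and every $f\in L_{2,q,\tau}$, the integrals $a_k=\int_0^1 f(x)\overline{\varphi_k(x)}\,dx$ converge absolutely and $$\|a\|_{\Lambda_{2,q,\tau}}\le C\,\|f\|_{L_{2,q,\tau}} .$$ (2) In the case $\tau=q$: there is a constant $C=C(q,M)$ such that for every such system and every $f\in L_{2,q}$ the integrals $a_k$ converge absolutely and $$\Big(\sum_{k=0}^\infty\Big(\sup_{s\ge \max(k,1)}\Big(\frac1s\sum_{m=1}^{2^s}(a_m^*)^2\Big)^{1/2}\Big)^{q}\Big)^{1/q}\le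 C\,\|f\|_{L_{2,q}} .$$ (3) The left-hand side of (2) dominates the Sinnamon–Tikhonov lower bound: there is a constant $C=C(q)$ such that for every complex sequence $a$ $$\Big(\sum_{n=1}^\infty\frac{1}{n\,(\log(n+1))^{q/2}}\Big(\sum_{j=1}^{n}(a_j^*)^2\Big)^{q/2}\Big)^{1/q}\le C\Big(\sum_{k=0}^\infty\Big(\sup_{s\ge \max(k,1)}\Big(\frac1s\sum_{m=1}^{2^s}(a_m^*)^2\Big)^{1/2}\Big)^{q}\Big)^{1/q};$$ for $q=\infty$ the left-hand side is $\sup_{n\ge1}(\log(n+1))^{-1/2}\big(\sum_{j=1}^n(a_j^*)^2\big)^{1/2}$. -/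

import Mathlib

open MeasureTheory Set
open scoped ENNReal NNReal ComplexConjugate

noncomputable section

namespace HerzBochkarev

/-- Lebesgue measure on `[0,1]`. -/
abbrev unitMeasure : Measure ℝ := volume.restrict (Icc (0 : ℝ) 1)

/-- The distribution function `D_f(r) = |{x ∈ [0,1] : |f(x)| > r}|`. -/
def distribution (f : ℝ → ℂ) (r : ℝ≥0∞) : ℝ≥0∞ :=
  unitMeasure {x | r < ‖f x‖ₑ}

/-- The non-increasing rearrangement `f^*(t) = inf {r : D_f(r) ≤ t}`, `t > 0`
(the value is `∞` if no finite `r` qualifies). -/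
def rearrangement (f : ℝ → ℂ) (t : ℝ) : ℝ≥0∞ :=
  sInf {r : ℝ≥0∞ | distribution f r ≤ ENNReal.ofReal t}

/-- The non-increasing rearrangement of a sequence of nonnegative terms: for `n ≥ 1`,
`seqRearrangement b n` is the `n`-th entry `b_n^* = inf {r : #{k : b_k > r} ≤ n - 1}`.
The positions are counted from `n = 1`; the value at `n = 0` is not used. -/
def seqRearrangement (b : ℕ → ℝ≥0∞) (n : ℕ) : ℝ≥0∞ :=
  sInf {r : ℝ≥0∞ | {k | r < b k}.encard < n}

/-- The non-increasing rearrangement `a_n^*`, `n ≥ 1`, of the moduli of a complex sequence. -/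
def coeffRearrangement (a : ℕ → ℂ) (n : ℕ) : ℝ≥0∞ :=
  seqRearrangement (fun k => ‖a k‖ₑ) n

/-- The Lorentz functional `(∑_{k ≥ 1} (k^{1/q} F_k)^τ / k)^{1/τ}` of a sequence `(F_k)_{k ≥ 1}`,
and `sup_{k ≥ 1} k^{1/q} F_k` for `τ = ∞`; here `1/∞ = 0`. -/
def lorentzSeq (q τ : ℝ≥0∞) (F : ℕ → ℝ≥0∞) : ℝ≥0∞ :=
  if τ = ∞ then ⨆ k : ℕ, ((k + 1 : ℕ) : ℝ≥0∞) ^ (1 / q.toReal) * F (k + 1)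
  else (∑' k : ℕ, (((k + 1 : ℕ) : ℝ≥0∞) ^ (1 / q.toReal) * F (k + 1)) ^ τ.toReal
    * ((k + 1 : ℕ) : ℝ≥0∞)⁻¹) ^ (1 / τ.toReal)

/-- The Lorentz quasi-norm of `f` in `L_{p,q}([0,1])`, `0 < p < ∞`, `0 < q ≤ ∞`. -/
def lorentzNorm (p : ℝ) (q : ℝ≥0∞) (f : ℝ → ℂ) : ℝ≥0∞ :=
  if q = ∞ then ⨆ t ∈ Ioc (0 : ℝ) 1, ENNReal.ofReal t ^ (1 / p) * rearrangement f t
  else (∫⁻ t in Ioc (0 : ℝ) 1,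
    (ENNReal.ofReal t ^ (1 / p) * rearrangement f t) ^ q.toReal * ENNReal.ofReal t⁻¹)
      ^ (1 / q.toReal)

/-- `ξ_m(f) = (∫_{2^{-m-1}}^{2^{-m}} f^*(t)^p dt)^{1/p}`, `m = 0, 1, 2, …`. -/
def dyadicBlock (p : ℝ) (f : ℝ → ℂ) (m : ℕ) : ℝ≥0∞ :=
  (∫⁻ t in Ioc ((2 : ℝ)⁻¹ ^ (m + 1)) ((2 : ℝ)⁻¹ ^ m), rearrangement f t ^ p) ^ (1 / p)

/-- The quasi-norm of `f` in `L_{p,q,τ}([0,1])`, `0 < p < ∞`, `0 < q, τ ≤ ∞`: the Lorentz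
`(q, τ)` quasi-norm of the sequence `(ξ_m(f))_m`. -/
def lorentzNorm₃ (p : ℝ) (q τ : ℝ≥0∞) (f : ℝ → ℂ) : ℝ≥0∞ :=
  lorentzSeq q τ (seqRearrangement (dyadicBlock p f))

/-- `sup_{s ≥ k, s ≥ 1} ((1/s) ∑_{m=1}^{2^s} (a_m^*)^p)^{1/p}`, the supremum being over
integers `s`. -/
def dyadicSup (p : ℝ) (a : ℕ → ℂ) (k : ℕ) : ℝ≥0∞ :=
  ⨆ (s : ℕ) (_ : 1 ≤ s ∧ k ≤ s),
    ((s : ℝ≥0∞)⁻¹ * ∑ m ∈ Finset.Icc 1 (2 ^ s), coeffRearrangement a m ^ p) ^ (1 / p)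

/-- The quasi-norm of `a` in the sequence space `Λ_{p,q,τ}`, `0 < p < ∞`, `0 < q, τ ≤ ∞`. -/
def lambdaNorm (p : ℝ) (q τ : ℝ≥0∞) (a : ℕ → ℂ) : ℝ≥0∞ :=
  lorentzSeq q τ (dyadicSup p a)

/-- `(∑_{k ≥ 0} (sup_{s ≥ max(k,1)} ((1/s) ∑_{m=1}^{2^s} (a_m^*)^2)^{1/2})^q)^{1/q}`, with the
supremum over `k` for `q = ∞`. -/
def dyadicLowerBound (q : ℝ≥0∞) (a : ℕ → ℂ) : ℝ≥0∞ :=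
  if q = ∞ then ⨆ k : ℕ, dyadicSup 2 a k
  else (∑' k : ℕ, dyadicSup 2 a k ^ q.toReal) ^ (1 / q.toReal)

/-- `(log (n+1))^{-1/2} (∑_{j=1}^n (a_j^*)^2)^{1/2}`, for `n ≥ 1`. -/
def logAverage (a : ℕ → ℂ) (n : ℕ) : ℝ≥0∞ :=
  ENNReal.ofReal (Real.log (n + 1)) ^ (-(1 / 2) : ℝ)
    * (∑ j ∈ Finset.Icc 1 n, coeffRearrangement a j ^ (2 : ℝ)) ^ (1 / 2 : ℝ)

/-- `(∑_{n ≥ 1} 1 / (n (log (n+1))^{q/2}) (∑_{j=1}^n (a_j^*)^2)^{q/2})^{1/q}`, and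
`sup_{n ≥ 1} (log (n+1))^{-1/2} (∑_{j=1}^n (a_j^*)^2)^{1/2}` for `q = ∞`. -/
def logLowerBound (q : ℝ≥0∞) (a : ℕ → ℂ) : ℝ≥0∞ :=
  if q = ∞ then ⨆ n : ℕ, logAverage a (n + 1)
  else (∑' n : ℕ, ((n + 1 : ℕ) : ℝ≥0∞)⁻¹ * logAverage a (n + 1) ^ q.toReal) ^ (1 / q.toReal)

/-- The Fourier coefficients `a_k(f) = ∫_0^1 f(x) conj(φ_k(x)) dx`. -/
def coeff (φ : ℕ → Lp ℂ 2 unitMeasure) (f : ℝ → ℂ) (k : ℕ) : ℂ :=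
  ∫ x, f x * conj (φ k x) ∂unitMeasure

end HerzBochkarev

end

open HerzBochkarev

namespace HerzBochkarev

/-! ### Rearrangements of sequences -/

/-! The coefficient estimate reduces to a comparison of quadratic means, followed by a Hardy
inequality.

Fix `s` and cut `f = g + h` at the height `f^*(2^{-s})`. Equimeasurability gives `‖g‖_2² ≤ ∑_{m<s}
ξ_m² + 2 ξ_s²`, while `‖h‖_1 ≤ ∫_0^{2^{-s}} f^*` is at most a constant times `2^{-s/2} sup_m ξ_m`.
Bessel handles `g`, and `|φ_k| ≤ M` handles `h` one coefficient at a time. Over any `2^s` indices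
the factor `2^s` cancels the squared decay of `‖h‖_1`, so the sum of `|a_k|²` is bounded by a
constant times `∑_{j≤s} (ξ_j^*)²` (`sum_sq_coeff_le`). After division by `s`, the right side is the
squared quadratic mean of `ξ^*`. It does not increase with `s`, so the supremum over `s ≥ k` costs
nothing (`exists_dyadicSup_coeff_le`).

Taking quadratic means of non-increasing sequences is bounded in the `(q, τ)` Lorentz functional
because `1/q < 1/2` (`exists_lorentzSeq_le_of_le_quadraticMean`). This is the only place where `q >
2` is essential.

For `τ = q` the weights cancel, and each `ξ_m` is controlled by the `L_{2,q}` integral over the next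
dyadic block. The logarithmic bound follows because `log (n+1)` is comparable to `s` for `2^{s-1} ≤
n ≤ 2^s`, and `1/n` has mass at most one on a dyadic block. -/

lemma seqRearrangement_antitone (b : ℕ → ℝ≥0∞) : Antitone (seqRearrangement b) := by
  intro m n hmn
  refine sInf_le_sInf fun r hr => ?_
  exact lt_of_lt_of_le (show _ < ((m : ℕ) : ℕ∞) from hr) (by exact_mod_cast hmn)

lemma seqRearrangement_le_of_forall_le {b : ℕ → ℝ≥0∞} {c : ℝ≥0∞} (h : ∀ k, b k ≤ c) {n : ℕ}
    (hn : 1 ≤ n) : seqRearrangement b n ≤ c := by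
  refine sInf_le ?_
  have : {k | c < b k} = ∅ := by
    ext k; simpa using h k
  rw [Set.mem_ofPred_eq, this, encard_empty]
  exact_mod_cast hn

/-- The minimiser of `b` on `S` works: a level below that minimum is exceeded on all of `S`, hence
too often to be admissible in the infimum. -/
lemma exists_le_seqRearrangement_card (b : ℕ → ℝ≥0∞) {S : Finset ℕ} (hS : S.Nonempty) :
    ∃ m ∈ S, b m ≤ seqRearrangement b S.card := by
  obtain ⟨m, hm, hmin⟩ := S.exists_min_image b hS
  refine ⟨m, hm, le_sInf fun r hr => ?_⟩
  by_contra! hlt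
  have hsub : (S : Set ℕ) ⊆ {k | r < b k} := fun k hk => hlt.trans_le (hmin k hk)
  have := Set.encard_le_encard hsub
  rw [Set.encard_coe_eq_coe_finsetCard] at this
  exact absurd hr (not_lt.mpr this)

lemma le_seqRearrangement_one (b : ℕ → ℝ≥0∞) (m : ℕ) : b m ≤ seqRearrangement b 1 := by
  obtain ⟨k, hk, h⟩ := exists_le_seqRearrangement_card b (Finset.singleton_nonempty m)
  rw [Finset.mem_singleton] at hk
  simpa [hk] using h

lemma sum_rpow_le_sum_seqRearrangement (b : ℕ → ℝ≥0∞) {p : ℝ} (hp : 0 ≤ p) (n : ℕ) :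
    ∀ S : Finset ℕ, S.card = n →
      ∑ m ∈ S, b m ^ p ≤ ∑ k ∈ Finset.range n, seqRearrangement b (k + 1) ^ p := by
  induction n with
  | zero => intro S hS; simp [Finset.card_eq_zero.mp hS]
  | succ n ih =>
    intro S hS
    obtain ⟨m, hm, hle⟩ := exists_le_seqRearrangement_card b
      (Finset.card_pos.mp (by omega : 0 < S.card))
    rw [← Finset.sum_erase_add S _ hm, Finset.sum_range_succ]
    refine add_le_add (ih _ (by rw [Finset.card_erase_of_mem hm, hS]; rfl)) ?_
    rw [hS] at hle
    exact ENNReal.rpow_le_rpow hle hp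

/-- Rearranged values need not be attained by `b`, so a factor `2⁻¹` is given up. Half of a finite
positive `b_{n+1}^*` is exceeded at least `n + 1` times, hence at some index outside the `n` already
chosen. -/
lemma exists_finset_sum_seqRearrangement_le {b : ℕ → ℝ≥0∞} {c : ℝ≥0∞} (hc : c ≠ ∞)
    (h : ∀ k, b k ≤ c) {p : ℝ} (hp : 0 ≤ p) (n : ℕ) :
    ∃ S : Finset ℕ, S.card = n ∧
      ∑ k ∈ Finset.range n, (2⁻¹ * seqRearrangement b (k + 1)) ^ p ≤ ∑ m ∈ S, b m ^ p := by
  induction n with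
  | zero => exact ⟨∅, by simp⟩
  | succ n ih =>
    obtain ⟨S, hS, hle⟩ := ih
    suffices ∃ m ∉ S, 2⁻¹ * seqRearrangement b (n + 1) ≤ b m by
      obtain ⟨m, hm, hmle⟩ := this
      refine ⟨insert m S, by rw [Finset.card_insert_of_notMem hm, hS], ?_⟩
      rw [Finset.sum_insert hm, Finset.sum_range_succ, add_comm]
      exact add_le_add (ENNReal.rpow_le_rpow hmle hp) hle
    rcases eq_or_ne (seqRearrangement b (n + 1)) 0 with h0 | h0
    · obtain ⟨m, hm⟩ := Infinite.exists_notMem_finset S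
      exact ⟨m, hm, by simp [h0]⟩
    · have htop : seqRearrangement b (n + 1) ≠ ∞ :=
        ne_top_of_le_ne_top hc (seqRearrangement_le_of_forall_le h (by omega))
      have hlt : 2⁻¹ * seqRearrangement b (n + 1) < seqRearrangement b (n + 1) := by
        rw [mul_comm, ← div_eq_mul_inv]
        exact ENNReal.half_lt_self h0 htop
      have hcard : ((n + 1 : ℕ) : ℕ∞) ≤
          {k | 2⁻¹ * seqRearrangement b (n + 1) < b k}.encard := by
        by_contra! hcon
        exact absurd (sInf_le (a := 2⁻¹ * seqRearrangement b (n + 1))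
          (s := {r : ℝ≥0∞ | {k | r < b k}.encard < (n + 1 : ℕ)}) hcon) (not_le.mpr hlt)
      by_contra! hcon
      have hsub : {k | 2⁻¹ * seqRearrangement b (n + 1) < b k} ⊆ (S : Set ℕ) := by
        intro k hk
        by_contra hkS
        exact absurd (hcon k hkS) (not_lt.mpr (le_of_lt hk))
      have := hcard.trans (Set.encard_le_encard hsub)
      rw [Set.encard_coe_eq_coe_finsetCard, hS] at this
      have : n + 1 ≤ n := by exact_mod_cast this
      omega

/-! ### Power sums -/

lemma sum_rpow_sub_one_le {p : ℝ} (hp : 0 < p) (hp1 : p ≤ 1) (n : ℕ) :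
    ∑ j ∈ Finset.range n, ((j + 1 : ℕ) : ℝ) ^ (p - 1) ≤ p⁻¹ * (n : ℝ) ^ p := by
  induction n with
  | zero => simp [hp.ne']
  | succ n ih =>
    rw [Finset.sum_range_succ]
    have hx : (0 : ℝ) < ((n + 1 : ℕ) : ℝ) := by positivity
    have hB := rpow_one_add_le_one_add_mul_self (s := -(((n + 1 : ℕ) : ℝ))⁻¹) (p := p)
      (by rw [neg_le_neg_iff]; exact inv_le_one_of_one_le₀ (by push_cast; linarith [n.cast_nonneg (α := ℝ)]))
      hp.le hp1
    have h1 : (n : ℝ) = ((n + 1 : ℕ) : ℝ) * (1 + -(((n + 1 : ℕ) : ℝ))⁻¹) := by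
      field_simp; push_cast; ring
    have hnn : 0 ≤ 1 + -(((n + 1 : ℕ) : ℝ))⁻¹ := by
      have : (((n + 1 : ℕ) : ℝ))⁻¹ ≤ 1 :=
        inv_le_one_of_one_le₀ (by push_cast; linarith [n.cast_nonneg (α := ℝ)])
      linarith
    have h2 : (n : ℝ) ^ p = ((n + 1 : ℕ) : ℝ) ^ p * (1 + -(((n + 1 : ℕ) : ℝ))⁻¹) ^ p := by
      rw [← Real.mul_rpow hx.le hnn, ← h1]
    have h3 : (n : ℝ) ^ p ≤ ((n + 1 : ℕ) : ℝ) ^ p - p * ((n + 1 : ℕ) : ℝ) ^ (p - 1) := by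
      rw [h2, Real.rpow_sub_one hx.ne']
      refine (mul_le_mul_of_nonneg_left hB (by positivity)).trans (le_of_eq ?_)
      field_simp
      ring
    have h4 : p⁻¹ * (n : ℝ) ^ p ≤
        p⁻¹ * (((n + 1 : ℕ) : ℝ) ^ p - p * ((n + 1 : ℕ) : ℝ) ^ (p - 1)) :=
      mul_le_mul_of_nonneg_left h3 (by positivity)
    rw [mul_sub, inv_mul_cancel_left₀ hp.ne'] at h4
    linarith

/-- For `p ≤ 1` every summand is at least `n^{p-1}`; for `p ≥ 1` Bernoulli's inequality bounds the
increments of `n^p`. -/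
lemma rpow_le_mul_sum_rpow_sub_one {p : ℝ} (hp : 0 < p) (n : ℕ) :
    (n : ℝ) ^ p ≤ (p + 1) * ∑ j ∈ Finset.range n, ((j + 1 : ℕ) : ℝ) ^ (p - 1) := by
  rcases le_total p 1 with hp1 | hp1
  · rcases Nat.eq_zero_or_pos n with rfl | hn
    · simp [hp.ne']
    have hn' : (0 : ℝ) < n := by exact_mod_cast hn
    have h1 : (n : ℝ) ^ p ≤ ∑ j ∈ Finset.range n, ((j + 1 : ℕ) : ℝ) ^ (p - 1) := by
      calc (n : ℝ) ^ p = ∑ j ∈ Finset.range n, (n : ℝ) ^ (p - 1) := by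
            rw [Finset.sum_const, Finset.card_range, nsmul_eq_mul, Real.rpow_sub_one hn'.ne']
            field_simp
        _ ≤ _ := Finset.sum_le_sum fun j hj =>
            Real.rpow_le_rpow_of_nonpos (by positivity)
              (by exact_mod_cast Finset.mem_range.mp hj) (by linarith)
    have h2 : 0 ≤ ∑ j ∈ Finset.range n, ((j + 1 : ℕ) : ℝ) ^ (p - 1) :=
      Finset.sum_nonneg fun _ _ => by positivity
    nlinarith
  · induction n with
    | zero => simp [hp.ne']
    | succ n ih =>
      rw [Finset.sum_range_succ]
      have hx : (0 : ℝ) < ((n + 1 : ℕ) : ℝ) := by positivity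
      have hinv : (((n + 1 : ℕ) : ℝ))⁻¹ ≤ 1 :=
        inv_le_one_of_one_le₀ (by push_cast; linarith [n.cast_nonneg (α := ℝ)])
      have hB := one_add_mul_self_le_rpow_one_add (s := -(((n + 1 : ℕ) : ℝ))⁻¹) (p := p)
        (by linarith) hp1
      have h1 : (n : ℝ) = ((n + 1 : ℕ) : ℝ) * (1 + -(((n + 1 : ℕ) : ℝ))⁻¹) := by
        field_simp; push_cast; ring
      have h2 : (n : ℝ) ^ p = ((n + 1 : ℕ) : ℝ) ^ p * (1 + -(((n + 1 : ℕ) : ℝ))⁻¹) ^ p := by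
        rw [← Real.mul_rpow hx.le (by linarith), ← h1]
      have h3 : ((n + 1 : ℕ) : ℝ) ^ p - p * ((n + 1 : ℕ) : ℝ) ^ (p - 1) ≤ (n : ℝ) ^ p := by
        rw [h2, Real.rpow_sub_one hx.ne']
        refine le_trans (le_of_eq ?_) (mul_le_mul_of_nonneg_left hB (by positivity))
        field_simp
        ring
      have h4 : 0 ≤ ((n + 1 : ℕ) : ℝ) ^ (p - 1) := by positivity
      nlinarith

lemma mul_rpow_neg_sub_one_le {δ x : ℝ} (hδ : 0 < δ) (hx : 0 < x) :
    δ * (x + 1) ^ (-δ - 1) ≤ x ^ (-δ) - (x + 1) ^ (-δ) := by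
  have hx1 : 0 < x + 1 := by linarith
  have h1 : x ^ (-δ) = (x + 1) ^ (-δ) * ((x + 1) / x) ^ δ := by
    rw [Real.div_rpow hx1.le hx.le, Real.rpow_neg hx1.le, Real.rpow_neg hx.le]
    field_simp
  have h2 : 1 + δ * (x + 1)⁻¹ ≤ ((x + 1) / x) ^ δ := by
    have hlog : (x + 1)⁻¹ ≤ Real.log ((x + 1) / x) := by
      have := Real.one_sub_inv_le_log_of_pos (x := (x + 1) / x) (by positivity)
      refine le_trans (le_of_eq ?_) this
      field_simp; ring
    rw [Real.rpow_def_of_pos (by positivity)]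
    have := Real.add_one_le_exp (Real.log ((x + 1) / x) * δ)
    nlinarith
  have h3 := mul_le_mul_of_nonneg_left h2 (by positivity : 0 ≤ (x + 1) ^ (-δ))
  rw [h1, Real.rpow_sub_one hx1.ne']
  rw [mul_add] at h3
  have h4 : δ * ((x + 1) ^ (-δ) / (x + 1)) = (x + 1) ^ (-δ) * (δ * (x + 1)⁻¹) := by ring
  linarith

lemma sum_range_shift_rpow_le {δ : ℝ} (hδ : 0 < δ) (i n : ℕ) :
    ∑ k ∈ Finset.range n, ((i + k + 1 : ℕ) : ℝ) ^ (-δ - 1) ≤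
      (1 + δ⁻¹) * ((i + 1 : ℕ) : ℝ) ^ (-δ) := by
  -- The subtracted term makes the induction telescope; the `1` in `1 + δ⁻¹` pays for the first
  -- summand.
  suffices ∀ n : ℕ, ∑ k ∈ Finset.range (n + 1), ((i + k + 1 : ℕ) : ℝ) ^ (-δ - 1) ≤
      (1 + δ⁻¹) * ((i + 1 : ℕ) : ℝ) ^ (-δ) - δ⁻¹ * ((i + n + 1 : ℕ) : ℝ) ^ (-δ) by
    rcases n with _ | n
    · simp only [Finset.range_zero, Finset.sum_empty]; positivity
    · exact (this n).trans (sub_le_self _ (by positivity))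
  intro n
  induction n with
  | zero =>
    have : ((i + 1 : ℕ) : ℝ) ^ (-δ - 1) ≤ ((i + 1 : ℕ) : ℝ) ^ (-δ) :=
      Real.rpow_le_rpow_of_exponent_le (by push_cast; linarith [i.cast_nonneg (α := ℝ)])
        (by linarith)
    simp only [zero_add, Finset.range_one, Finset.sum_singleton, add_zero]
    linarith
  | succ n ih =>
    rw [Finset.sum_range_succ]
    have h := mul_rpow_neg_sub_one_le hδ (x := ((i + n + 1 : ℕ) : ℝ)) (by positivity)
    have h' := mul_le_mul_of_nonneg_left h (by positivity : 0 ≤ δ⁻¹)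
    rw [inv_mul_cancel_left₀ hδ.ne', mul_sub] at h'
    have e : ((i + (n + 1) + 1 : ℕ) : ℝ) = ((i + n + 1 : ℕ) : ℝ) + 1 := by push_cast; ring
    rw [e]
    linarith

lemma natCast_rpow_eq_ofReal (n : ℕ) (p : ℝ) :
    ((n + 1 : ℕ) : ℝ≥0∞) ^ p = ENNReal.ofReal (((n + 1 : ℕ) : ℝ) ^ p) := by
  rw [← ENNReal.ofReal_rpow_of_pos (by positivity), ENNReal.ofReal_natCast]

lemma natCast_rpow_add (n : ℕ) (x y : ℝ) :
    ((n + 1 : ℕ) : ℝ≥0∞) ^ (x + y) = ((n + 1 : ℕ) : ℝ≥0∞) ^ x * ((n + 1 : ℕ) : ℝ≥0∞) ^ y :=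
  ENNReal.rpow_add x y (by simp) (ENNReal.natCast_ne_top _)

lemma exists_sum_natCast_rpow_sub_one_le {p : ℝ} (hp : 0 < p) (hp1 : p ≤ 1) :
    ∃ C : ℝ≥0, ∀ k : ℕ, ∑ j ∈ Finset.range (k + 1), ((j + 1 : ℕ) : ℝ≥0∞) ^ (p - 1) ≤
      C * ((k + 1 : ℕ) : ℝ≥0∞) ^ p := by
  refine ⟨(p⁻¹).toNNReal, fun k => ?_⟩
  simp_rw [natCast_rpow_eq_ofReal]
  rw [← ENNReal.ofReal_sum_of_nonneg (fun _ _ => by positivity), ENNReal.ofNNReal_toNNReal,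
    ← ENNReal.ofReal_mul (by positivity)]
  exact ENNReal.ofReal_le_ofReal (sum_rpow_sub_one_le hp hp1 (k + 1))

lemma exists_natCast_rpow_le_sum {p : ℝ} (hp : 0 < p) :
    ∃ C : ℝ≥0, ∀ k : ℕ, ((k + 1 : ℕ) : ℝ≥0∞) ^ p ≤
      C * ∑ j ∈ Finset.range (k + 1), ((j + 1 : ℕ) : ℝ≥0∞) ^ (p - 1) := by
  refine ⟨(p + 1).toNNReal, fun k => ?_⟩
  simp_rw [natCast_rpow_eq_ofReal]
  rw [← ENNReal.ofReal_sum_of_nonneg (fun _ _ => by positivity), ENNReal.ofNNReal_toNNReal,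
    ← ENNReal.ofReal_mul (by positivity)]
  exact ENNReal.ofReal_le_ofReal (rpow_le_mul_sum_rpow_sub_one hp (k + 1))

lemma exists_tsum_shift_rpow_le {δ : ℝ} (hδ : 0 < δ) :
    ∃ C : ℝ≥0, ∀ i : ℕ, ∑' k : ℕ, ((i + k + 1 : ℕ) : ℝ≥0∞) ^ (-δ - 1) ≤
      C * ((i + 1 : ℕ) : ℝ≥0∞) ^ (-δ) := by
  refine ⟨(1 + δ⁻¹).toNNReal, fun i => ENNReal.tsum_le_of_sum_range_le fun n => ?_⟩
  simp_rw [natCast_rpow_eq_ofReal]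
  rw [← ENNReal.ofReal_sum_of_nonneg (fun _ _ => by positivity), ENNReal.ofNNReal_toNNReal,
    ← ENNReal.ofReal_mul (by positivity)]
  exact ENNReal.ofReal_le_ofReal (sum_range_shift_rpow_le hδ i n)

/-! ### The Hardy inequality -/

/-- The quadratic mean of the first `k` terms of a sequence, `(1/k ∑_{j=1}^k b_j^2)^{1/2}`. -/
noncomputable def quadraticMean (b : ℕ → ℝ≥0∞) (k : ℕ) : ℝ≥0∞ :=
  ((k : ℝ≥0∞)⁻¹ * ∑ j ∈ Finset.range k, b (j + 1) ^ (2 : ℝ)) ^ (1 / 2 : ℝ)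

/-- Since `b_j ≤ j^{-γ} S` and `2γ < 1`, the squares sum to at most a constant times `k^{1-2γ} S²`.
The bound `S` is left free: it comes from a supremum when `τ = ∞` and from a sum when `τ < ∞`. -/
lemma exists_quadraticMean_le {γ : ℝ} (hγ0 : 0 ≤ γ) (hγ : γ < 1 / 2) :
    ∃ C : ℝ≥0, ∀ (b : ℕ → ℝ≥0∞) (S : ℝ≥0∞) (k : ℕ),
      (∀ j ≤ k, ((j + 1 : ℕ) : ℝ≥0∞) ^ γ * b (j + 1) ≤ S) →
      ((k + 1 : ℕ) : ℝ≥0∞) ^ γ * quadraticMean b (k + 1) ≤ C * S := by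
  obtain ⟨C, hC⟩ := exists_sum_natCast_rpow_sub_one_le (p := 1 - 2 * γ) (by linarith) (by linarith)
  refine ⟨C ^ (1 / 2 : ℝ), fun b S k hS => ?_⟩
  have hb : ∀ j ≤ k, b (j + 1) ≤ ((j + 1 : ℕ) : ℝ≥0∞) ^ (-γ) * S := fun j hj => by
    refine le_trans (le_of_eq ?_) (mul_le_mul_right (hS j hj) _)
    rw [← mul_assoc, ← natCast_rpow_add, neg_add_cancel, ENNReal.rpow_zero, one_mul]
  have hsum : ∑ j ∈ Finset.range (k + 1), b (j + 1) ^ (2 : ℝ) ≤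
      C * ((k + 1 : ℕ) : ℝ≥0∞) ^ (1 - 2 * γ) * S ^ (2 : ℝ) := by
    refine le_trans ?_ (mul_le_mul_left (hC k) _)
    rw [Finset.sum_mul]
    refine Finset.sum_le_sum fun j hj => ?_
    refine (ENNReal.rpow_le_rpow (hb j (by simpa [Nat.lt_succ_iff] using hj))
      (by norm_num)).trans (le_of_eq ?_)
    rw [ENNReal.mul_rpow_of_nonneg _ _ (by norm_num), ← ENNReal.rpow_mul]
    congr 2
    ring
  have hk : ((k + 1 : ℕ) : ℝ≥0∞) ^ (2 * γ) * (((k + 1 : ℕ) : ℝ≥0∞)⁻¹ *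
      (C * ((k + 1 : ℕ) : ℝ≥0∞) ^ (1 - 2 * γ) * S ^ (2 : ℝ))) = C * S ^ (2 : ℝ) := by
    rw [← ENNReal.rpow_neg_one]
    calc _ = ((k + 1 : ℕ) : ℝ≥0∞) ^ (2 * γ) * ((k + 1 : ℕ) : ℝ≥0∞) ^ (-1 : ℝ) *
        ((k + 1 : ℕ) : ℝ≥0∞) ^ (1 - 2 * γ) * (C * S ^ (2 : ℝ)) := by ring
      _ = _ := by
        rw [← natCast_rpow_add, ← natCast_rpow_add,
          show 2 * γ + -1 + (1 - 2 * γ) = 0 by ring, ENNReal.rpow_zero, one_mul]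
  calc ((k + 1 : ℕ) : ℝ≥0∞) ^ γ * quadraticMean b (k + 1)
      = (((k + 1 : ℕ) : ℝ≥0∞) ^ (2 * γ) * (((k + 1 : ℕ) : ℝ≥0∞)⁻¹ *
          ∑ j ∈ Finset.range (k + 1), b (j + 1) ^ (2 : ℝ))) ^ (1 / 2 : ℝ) := by
        rw [ENNReal.mul_rpow_of_nonneg (z := (1 / 2 : ℝ)) _ _ (by norm_num), ← ENNReal.rpow_mul,
          quadraticMean]
        congr 2
        ring
    _ ≤ (C * S ^ (2 : ℝ)) ^ (1 / 2 : ℝ) := by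
        rw [← hk]
        gcongr
    _ = _ := by
        rw [ENNReal.mul_rpow_of_nonneg (z := (1 / 2 : ℝ)) _ _ (by norm_num), ← ENNReal.rpow_mul,
          ENNReal.coe_rpow_of_nonneg _ (by norm_num)]
        norm_num

/-- Monotonicity replaces `b_j` by each earlier `b_i`, so a weighted maximum becomes a weighted sum
for every `r > 0`. This spares Minkowski's inequality and so admits small `τ`. -/
lemma exists_rpow_mul_rpow_le_sum {γ r : ℝ} (hγ : 0 < γ) (hr : 0 < r) :
    ∃ C : ℝ≥0, ∀ b : ℕ → ℝ≥0∞, Antitone b → ∀ j : ℕ,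
      (((j + 1 : ℕ) : ℝ≥0∞) ^ γ * b (j + 1)) ^ r ≤
        C * ∑ i ∈ Finset.range (j + 1), ((i + 1 : ℕ) : ℝ≥0∞) ^ (γ * r - 1) * b (i + 1) ^ r := by
  obtain ⟨C, hC⟩ := exists_natCast_rpow_le_sum (p := γ * r) (by positivity)
  refine ⟨C, fun b hb j => ?_⟩
  rw [ENNReal.mul_rpow_of_nonneg _ _ hr.le, ← ENNReal.rpow_mul]
  refine (mul_le_mul_left (hC j) _).trans ?_
  rw [mul_assoc, Finset.sum_mul]
  gcongr with i hi
  exact hb (by have := Finset.mem_range.mp hi; omega)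

lemma tsum_mul_sum_range_eq (w u : ℕ → ℝ≥0∞) :
    ∑' k, w k * ∑ i ∈ Finset.range (k + 1), u i = ∑' i, u i * ∑' k, w (i + k) := by
  have h1 : ∀ k, w k * ∑ i ∈ Finset.range (k + 1), u i =
      ∑' i, if i ≤ k then w k * u i else 0 := fun k => by
    rw [Finset.mul_sum, tsum_eq_sum (s := Finset.range (k + 1))]
    · exact Finset.sum_congr rfl fun i hi => by
        rw [if_pos (by have := Finset.mem_range.mp hi; omega)]
    · intro i hi
      rw [if_neg (by rw [Finset.mem_range] at hi; omega)]
  simp_rw [h1]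
  rw [ENNReal.tsum_comm]
  congr 1
  ext i
  rw [← ENNReal.tsum_mul_left, ← ENNReal.summable.sum_add_tsum_nat_add' (k := i),
    Finset.sum_eq_zero, zero_add]
  · congr 1
    ext k
    rw [if_pos (by omega), add_comm k i, mul_comm]
  · intro k hk
    rw [if_neg (by have := Finset.mem_range.mp hk; omega)]

lemma exists_lorentzSeq_le_of_le_quadraticMean {q τ : ℝ≥0∞} (hq : 2 < q) (hτ : 0 < τ) (K : ℝ≥0) :
    ∃ C : ℝ≥0, ∀ b F : ℕ → ℝ≥0∞, Antitone b →
      (∀ k, F (k + 1) ≤ K * quadraticMean b (k + 1)) →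
      lorentzSeq q τ F ≤ C * lorentzSeq q τ b := by
  set θ := 1 / q.toReal with hθ
  have hθ0 : 0 ≤ θ := by positivity
  have hθ2 : θ < 1 / 2 := by
    rcases eq_or_ne q ∞ with rfl | hqt
    · simp [hθ]
    · have : 2 < q.toReal := by
        simpa using (ENNReal.toReal_lt_toReal (by simp) hqt).mpr hq
      exact one_div_lt_one_div_of_lt (by norm_num) this
  -- Room on both sides of `γ`: `γ < 1/2` bounds the quadratic mean, and `γ > 1/q` makes the tail
  -- sums of `k^{-(γ-1/q)τ-1}` converge when `τ < ∞`.
  obtain ⟨γ, hγθ, hγ2⟩ := exists_between hθ2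
  have hγ0 : 0 < γ := hθ0.trans_lt hγθ
  obtain ⟨C₁, hC₁⟩ := exists_quadraticMean_le hγ0.le hγ2
  rcases eq_or_ne τ ∞ with rfl | hτt
  · refine ⟨K * C₁, fun b F _ hF => ?_⟩
    simp only [lorentzSeq, if_true]
    refine iSup_le fun k => ?_
    set X := ⨆ k : ℕ, ((k + 1 : ℕ) : ℝ≥0∞) ^ θ * b (k + 1) with hX
    have hS : ∀ j ≤ k, ((j + 1 : ℕ) : ℝ≥0∞) ^ γ * b (j + 1) ≤
        ((k + 1 : ℕ) : ℝ≥0∞) ^ (γ - θ) * X := fun j hj => by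
      calc ((j + 1 : ℕ) : ℝ≥0∞) ^ γ * b (j + 1)
          = ((j + 1 : ℕ) : ℝ≥0∞) ^ (γ - θ) * (((j + 1 : ℕ) : ℝ≥0∞) ^ θ * b (j + 1)) := by
            rw [← mul_assoc, ← natCast_rpow_add, sub_add_cancel]
        _ ≤ _ := by
            refine mul_le_mul' (ENNReal.rpow_le_rpow ?_ (by linarith))
              (le_iSup (fun k : ℕ => ((k + 1 : ℕ) : ℝ≥0∞) ^ θ * b (k + 1)) j)
            exact_mod_cast Nat.succ_le_succ hj
    calc ((k + 1 : ℕ) : ℝ≥0∞) ^ θ * F (k + 1)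
        ≤ ((k + 1 : ℕ) : ℝ≥0∞) ^ θ * (K * quadraticMean b (k + 1)) := by gcongr; exact hF k
      _ = K * (((k + 1 : ℕ) : ℝ≥0∞) ^ (θ - γ) *
            (((k + 1 : ℕ) : ℝ≥0∞) ^ γ * quadraticMean b (k + 1))) := by
          rw [← mul_assoc (_ ^ (θ - γ)), ← natCast_rpow_add, sub_add_cancel]; ring
      _ ≤ K * (((k + 1 : ℕ) : ℝ≥0∞) ^ (θ - γ) *
            (C₁ * (((k + 1 : ℕ) : ℝ≥0∞) ^ (γ - θ) * X))) := by
          exact mul_le_mul_right (mul_le_mul_right (hC₁ b _ k hS) _) _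
      _ = K * C₁ * ((((k + 1 : ℕ) : ℝ≥0∞) ^ (θ - γ) * ((k + 1 : ℕ) : ℝ≥0∞) ^ (γ - θ)) * X) := by
          ring
      _ = _ := by rw [← natCast_rpow_add]; simp
  · have hr : 0 < τ.toReal := ENNReal.toReal_pos hτ.ne' hτt
    set r := τ.toReal with hrdef
    obtain ⟨C₂, hC₂⟩ := exists_rpow_mul_rpow_le_sum hγ0 hr
    have hδ : 0 < (γ - θ) * r := mul_pos (by linarith) hr
    obtain ⟨C₃, hC₃⟩ := exists_tsum_shift_rpow_le hδ
    refine ⟨K * C₁ * (C₂ * C₃) ^ (1 / r), fun b F hb hF => ?_⟩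
    simp only [lorentzSeq, if_neg hτt, ← hθ, ← hrdef]
    set u : ℕ → ℝ≥0∞ := fun i => ((i + 1 : ℕ) : ℝ≥0∞) ^ (γ * r - 1) * b (i + 1) ^ r with hu
    have hterm : ∀ k : ℕ, (((k + 1 : ℕ) : ℝ≥0∞) ^ θ * F (k + 1)) ^ r * ((k + 1 : ℕ) : ℝ≥0∞)⁻¹ ≤
        (K * C₁ : ℝ≥0∞) ^ r * C₂ * (((k + 1 : ℕ) : ℝ≥0∞) ^ (-((γ - θ) * r) - 1) *
          ∑ i ∈ Finset.range (k + 1), u i) := fun k => by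
      set S : ℝ≥0∞ := (C₂ * ∑ i ∈ Finset.range (k + 1), u i) ^ (1 / r) with hS
      have hSle : ∀ j ≤ k, ((j + 1 : ℕ) : ℝ≥0∞) ^ γ * b (j + 1) ≤ S := fun j hj => by
        rw [hS, one_div, ENNReal.le_rpow_inv_iff hr]
        refine (hC₂ b hb j).trans ?_
        gcongr
      have hSr : S ^ r = C₂ * ∑ i ∈ Finset.range (k + 1), u i := by
        rw [hS, one_div, ENNReal.rpow_inv_rpow hr.ne']
      calc _ ≤ (((k + 1 : ℕ) : ℝ≥0∞) ^ θ * (K * quadraticMean b (k + 1))) ^ r *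
            ((k + 1 : ℕ) : ℝ≥0∞)⁻¹ := by gcongr; exact hF k
        _ = (K * (((k + 1 : ℕ) : ℝ≥0∞) ^ (θ - γ) *
            (((k + 1 : ℕ) : ℝ≥0∞) ^ γ * quadraticMean b (k + 1)))) ^ r *
              ((k + 1 : ℕ) : ℝ≥0∞)⁻¹ := by
          rw [← mul_assoc (_ ^ (θ - γ)), ← natCast_rpow_add, sub_add_cancel]; ring_nf
        _ ≤ (K * (((k + 1 : ℕ) : ℝ≥0∞) ^ (θ - γ) * (C₁ * S))) ^ r *
              ((k + 1 : ℕ) : ℝ≥0∞)⁻¹ := by 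
          gcongr ?_ ^ r * _
          exact mul_le_mul_right (mul_le_mul_right (hC₁ b S k hSle) _) _
        _ = (K * C₁ * ((k + 1 : ℕ) : ℝ≥0∞) ^ (θ - γ) * S) ^ r *
              ((k + 1 : ℕ) : ℝ≥0∞)⁻¹ := by ring_nf
        _ = (K * C₁ : ℝ≥0∞) ^ r * C₂ * ((((k + 1 : ℕ) : ℝ≥0∞) ^ ((θ - γ) * r) *
              ((k + 1 : ℕ) : ℝ≥0∞) ^ (-1 : ℝ)) * ∑ i ∈ Finset.range (k + 1), u i) := by
          rw [ENNReal.mul_rpow_of_nonneg _ _ hr.le, ENNReal.mul_rpow_of_nonneg _ _ hr.le, hSr,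
            ← ENNReal.rpow_mul, ENNReal.rpow_neg_one]
          ring
        _ = _ := by
          rw [← natCast_rpow_add]
          congr 4
          ring
    have hsum : ∑' k : ℕ, (((k + 1 : ℕ) : ℝ≥0∞) ^ θ * F (k + 1)) ^ r * ((k + 1 : ℕ) : ℝ≥0∞)⁻¹ ≤
        (K * C₁ : ℝ≥0∞) ^ r * (C₂ * C₃) * ∑' k : ℕ, (((k + 1 : ℕ) : ℝ≥0∞) ^ θ * b (k + 1)) ^ r *
          ((k + 1 : ℕ) : ℝ≥0∞)⁻¹ := by
      refine (ENNReal.tsum_le_tsum hterm).trans ?_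
      -- After the order of summation is exchanged, the tail from `i` supplies `i^{-(γ-θ)r}`, which
      -- turns the weight `i^{γr-1}` back into `i^{θr-1}`.
      rw [ENNReal.tsum_mul_left, tsum_mul_sum_range_eq
        (fun k => ((k + 1 : ℕ) : ℝ≥0∞) ^ (-((γ - θ) * r) - 1)) u, mul_assoc, mul_assoc, mul_assoc]
      gcongr
      rw [← ENNReal.tsum_mul_left]
      refine ENNReal.tsum_le_tsum fun i => ?_
      refine (mul_le_mul_right (hC₃ i) _).trans (le_of_eq ?_)
      rw [hu, ENNReal.mul_rpow_of_nonneg _ _ hr.le, ← ENNReal.rpow_mul, ← ENNReal.rpow_neg_one]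
      calc _ = C₃ * (((i + 1 : ℕ) : ℝ≥0∞) ^ (γ * r - 1) *
            ((i + 1 : ℕ) : ℝ≥0∞) ^ (-((γ - θ) * r)) * b (i + 1) ^ r) := by ring
        _ = C₃ * (((i + 1 : ℕ) : ℝ≥0∞) ^ (θ * r) *
            ((i + 1 : ℕ) : ℝ≥0∞) ^ (-1 : ℝ) * b (i + 1) ^ r) := by
          rw [← natCast_rpow_add, ← natCast_rpow_add]
          congr 3
          ring
        _ = _ := by ring
    refine (ENNReal.rpow_le_rpow hsum (by positivity)).trans (le_of_eq ?_)
    rw [ENNReal.mul_rpow_of_nonneg _ _ (by positivity), ENNReal.mul_rpow_of_nonneg _ _ (by positivity),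
      one_div, ENNReal.rpow_rpow_inv hr.ne', ENNReal.coe_mul, ENNReal.coe_mul,
      ENNReal.coe_rpow_of_nonneg _ (by positivity), ENNReal.coe_mul]

/-! ### Rearrangements of functions -/

lemma distribution_antitone (f : ℝ → ℂ) : Antitone (distribution f) :=
  fun _ _ hrs => measure_mono fun _ hx => lt_of_le_of_lt hrs hx

lemma distribution_le_one (f : ℝ → ℂ) (r : ℝ≥0∞) : distribution f r ≤ 1 := by
  refine (measure_mono (subset_univ _)).trans ?_
  simp

/-- The infimum is attained: along admissible levels decreasing to it, the superlevel sets increase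
to the limiting one, and measure is continuous from below. -/
lemma distribution_rearrangement_le (f : ℝ → ℂ) (t : ℝ) :
    distribution f (rearrangement f t) ≤ ENNReal.ofReal t := by
  set A := {r : ℝ≥0∞ | distribution f r ≤ ENNReal.ofReal t} with hA
  have hne : A.Nonempty := ⟨∞, by simp [hA, distribution]⟩
  obtain ⟨u, hu, hlim, huA⟩ := exists_seq_tendsto_sInf hne (OrderBot.bddBelow A)
  have hset : {x | rearrangement f t < ‖f x‖ₑ} = ⋃ n, {x | u n < ‖f x‖ₑ} := by
    ext x
    rw [mem_iUnion]
    constructor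
    · intro hx
      exact (hlim.eventually (gt_mem_nhds hx)).exists
    · rintro ⟨n, hn⟩
      exact lt_of_le_of_lt (sInf_le (huA n)) hn
  have hmono : Monotone fun n => {x | u n < ‖f x‖ₑ} :=
    fun m n hmn x hx => lt_of_le_of_lt (hu hmn) hx
  rw [distribution, hset, hmono.measure_iUnion]
  exact iSup_le huA

lemma rearrangement_le_iff {f : ℝ → ℂ} {t : ℝ} {r : ℝ≥0∞} :
    rearrangement f t ≤ r ↔ distribution f r ≤ ENNReal.ofReal t :=
  ⟨fun h => (distribution_antitone f h).trans (distribution_rearrangement_le f t),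
    fun h => sInf_le h⟩

lemma rearrangement_antitone (f : ℝ → ℂ) : Antitone (rearrangement f) :=
  fun _ _ hst => rearrangement_le_iff.mpr
    ((distribution_rearrangement_le f _).trans (ENNReal.ofReal_le_ofReal hst))

lemma measurable_rearrangement (f : ℝ → ℂ) : Measurable (rearrangement f) :=
  (rearrangement_antitone f).measurable

lemma volume_lt_rearrangement (f : ℝ → ℂ) (r : ℝ≥0∞) :
    volume.restrict (Ioc (0 : ℝ) 1) {t | r < rearrangement f t} = distribution f r := by
  have hD : distribution f r ≠ ∞ := ne_top_of_le_ne_top (by simp) (distribution_le_one f r)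
  have h1 : (distribution f r).toReal ≤ 1 :=
    ENNReal.toReal_le_of_le_ofReal (by simp) (by simpa using distribution_le_one f r)
  have hset : {t | r < rearrangement f t} ∩ Ioc (0 : ℝ) 1 = Ioo 0 (distribution f r).toReal := by
    ext t
    have : r < rearrangement f t ↔ ENNReal.ofReal t < distribution f r := by
      rw [← not_le, rearrangement_le_iff, not_le]
    simp only [mem_inter_iff, mem_ofPred_eq, this, mem_Ioc, mem_Ioo]
    constructor
    · rintro ⟨h, h0, -⟩
      exact ⟨h0, (ENNReal.ofReal_lt_iff_lt_toReal h0.le hD).mp h⟩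
    · rintro ⟨h0, h⟩
      exact ⟨(ENNReal.ofReal_lt_iff_lt_toReal h0.le hD).mpr h, h0, h.le.trans h1⟩
  rw [Measure.restrict_apply (measurableSet_lt measurable_const (measurable_rearrangement f)),
    hset, Real.volume_Ioo, sub_zero, ENNReal.ofReal_toReal hD]

/-- Equimeasurability as an equality of laws, so that every integral of a function of `|f|`,
truncations included, transfers to `f^*`. -/
lemma map_enorm_eq_map_rearrangement {f : ℝ → ℂ} (hf : AEStronglyMeasurable f unitMeasure) :
    Measure.map (fun x => ‖f x‖ₑ) unitMeasure =
      Measure.map (rearrangement f) (volume.restrict (Ioc (0 : ℝ) 1)) := by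
  have hm := measurable_rearrangement f
  have hIoi : ∀ r, Measure.map (fun x => ‖f x‖ₑ) unitMeasure (Ioi r) =
      Measure.map (rearrangement f) (volume.restrict (Ioc (0 : ℝ) 1)) (Ioi r) := fun r => by
    rw [Measure.map_apply_of_aemeasurable hf.enorm measurableSet_Ioi,
      Measure.map_apply hm measurableSet_Ioi]
    exact (volume_lt_rearrangement f r).symm
  have : IsFiniteMeasure (Measure.map (fun x => ‖f x‖ₑ) unitMeasure) :=
    Measure.isFiniteMeasure_map _ _
  have : IsFiniteMeasure (Measure.map (rearrangement f) (volume.restrict (Ioc (0 : ℝ) 1))) :=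
    Measure.isFiniteMeasure_map _ _
  refine Measure.ext_of_Iic _ _ fun r => ?_
  rw [← compl_Ioi, measure_compl measurableSet_Ioi (measure_ne_top _ _),
    measure_compl measurableSet_Ioi (measure_ne_top _ _), hIoi,
    Measure.map_apply_of_aemeasurable hf.enorm MeasurableSet.univ,
    Measure.map_apply hm MeasurableSet.univ]
  simp

lemma lintegral_comp_enorm_eq {f : ℝ → ℂ} (hf : AEStronglyMeasurable f unitMeasure)
    {G : ℝ≥0∞ → ℝ≥0∞} (hG : Measurable G) :
    ∫⁻ x, G ‖f x‖ₑ ∂unitMeasure = ∫⁻ t in Ioc (0 : ℝ) 1, G (rearrangement f t) := by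
  rw [← lintegral_map hG (measurable_rearrangement f), ← map_enorm_eq_map_rearrangement hf,
    lintegral_map' hG.aemeasurable hf.enorm]

/-! ### Dyadic blocks -/

/-- The dyadic interval `(2^{-m-1}, 2^{-m}]`. -/
abbrev dyadicIoc (m : ℕ) : Set ℝ := Ioc ((2 : ℝ)⁻¹ ^ (m + 1)) ((2 : ℝ)⁻¹ ^ m)

lemma volume_dyadicIoc (m : ℕ) : volume (dyadicIoc m) = 2⁻¹ ^ (m + 1) := by
  rw [Real.volume_Ioc, show (2 : ℝ)⁻¹ ^ m - (2 : ℝ)⁻¹ ^ (m + 1) = (2 : ℝ)⁻¹ ^ (m + 1) by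
    rw [pow_succ]; ring, ENNReal.ofReal_pow (by positivity), ENNReal.ofReal_inv_of_pos (by norm_num)]
  simp

lemma dyadicBlock_rpow (f : ℝ → ℂ) (m : ℕ) :
    dyadicBlock 2 f m ^ (2 : ℝ) = ∫⁻ t in dyadicIoc m, rearrangement f t ^ (2 : ℝ) := by
  rw [dyadicBlock, one_div, ENNReal.rpow_inv_rpow (by norm_num)]

lemma setLIntegral_dyadicIoc_le {g : ℝ → ℝ≥0∞} (hg : Antitone g) (m : ℕ) :
    ∫⁻ t in dyadicIoc m, g t ≤ 2⁻¹ ^ (m + 1) * g ((2 : ℝ)⁻¹ ^ (m + 1)) := by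
  rw [mul_comm, ← volume_dyadicIoc]
  refine (setLIntegral_mono' measurableSet_Ioc fun t ht => hg ht.1.le).trans ?_
  rw [setLIntegral_const]

lemma le_setLIntegral_dyadicIoc {g : ℝ → ℝ≥0∞} (hg : Antitone g) (m : ℕ) :
    2⁻¹ ^ (m + 1) * g ((2 : ℝ)⁻¹ ^ m) ≤ ∫⁻ t in dyadicIoc m, g t := by
  rw [mul_comm, ← volume_dyadicIoc, ← setLIntegral_const]
  exact setLIntegral_mono' measurableSet_Ioc fun t ht => hg ht.2

lemma rearrangement_rpow_antitone (f : ℝ → ℂ) {p : ℝ} (hp : 0 ≤ p) :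
    Antitone fun t => rearrangement f t ^ p :=
  fun _ _ h => ENNReal.rpow_le_rpow (rearrangement_antitone f h) hp

lemma rearrangement_pow_le (f : ℝ → ℂ) (m : ℕ) :
    2⁻¹ ^ (m + 1) * rearrangement f ((2 : ℝ)⁻¹ ^ m) ^ (2 : ℝ) ≤ dyadicBlock 2 f m ^ (2 : ℝ) := by
  rw [dyadicBlock_rpow]
  exact le_setLIntegral_dyadicIoc (rearrangement_rpow_antitone f (by norm_num)) m

lemma Ioc_subset_iUnion_dyadicIoc (s : ℕ) :
    Ioc (0 : ℝ) ((2 : ℝ)⁻¹ ^ s) ⊆ ⋃ m, dyadicIoc (s + m) := by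
  intro t ht
  have h1 : (0 : ℝ) < (2 : ℝ)⁻¹ ^ s := by positivity
  obtain ⟨n, hn1, hn2⟩ := exists_nat_pow_near_of_lt_one (x := t / (2 : ℝ)⁻¹ ^ s) (y := (2 : ℝ)⁻¹)
    (div_pos ht.1 h1) ((div_le_one h1).mpr ht.2) (by norm_num) (by norm_num)
  rw [lt_div_iff₀ h1] at hn1
  rw [div_le_iff₀ h1] at hn2
  exact mem_iUnion.mpr ⟨n, by rw [add_assoc, pow_add, mul_comm]; exact hn1,
    by rw [pow_add, mul_comm]; exact hn2⟩

lemma Ioc_subset_biUnion_dyadicIoc (s : ℕ) :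
    Ioc ((2 : ℝ)⁻¹ ^ s) 1 ⊆ ⋃ m ∈ Finset.range s, dyadicIoc m := by
  intro t ht
  have h1 : (0 : ℝ) < (2 : ℝ)⁻¹ ^ s := by positivity
  obtain ⟨n, hn1, hn2⟩ := exists_nat_pow_near_of_lt_one (x := t) (y := (2 : ℝ)⁻¹)
    (h1.trans ht.1) ht.2 (by norm_num) (by norm_num)
  refine mem_iUnion₂.mpr ⟨n, ?_, hn1, hn2⟩
  rw [Finset.mem_range]
  exact (pow_lt_pow_iff_right_of_lt_one₀ (by norm_num) (by norm_num)).mp (ht.1.trans_le hn2)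

lemma lintegral_biUnion_finset_le' {α : Type*} [MeasurableSpace α] {μ : Measure α}
    (S : Finset ℕ) (A : ℕ → Set α) (g : α → ℝ≥0∞) :
    ∫⁻ x in ⋃ m ∈ S, A m, g x ∂μ ≤ ∑ m ∈ S, ∫⁻ x in A m, g x ∂μ := by
  classical
  induction S using Finset.induction_on with
  | empty => simp
  | insert a S ha ih =>
    rw [Finset.set_biUnion_insert, Finset.sum_insert ha]
    exact (lintegral_union_le _ _ _).trans (add_le_add le_rfl ih)

/-- The constant `∑_{m ≥ 0} 2^{-m/2}`. -/
noncomputable def halfGeomSum : ℝ≥0∞ := (1 - (2⁻¹ : ℝ≥0∞) ^ (1 / 2 : ℝ))⁻¹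

lemma halfGeomSum_ne_top : halfGeomSum ≠ ∞ := by
  rw [halfGeomSum, ENNReal.inv_ne_top, Ne, tsub_eq_zero_iff_le, not_le]
  exact ENNReal.rpow_lt_one (by simp) (by norm_num)

/-- On block `m` the function `f^*` is at most its value at the left endpoint, which block `m + 1`
controls through `ξ_{m+1} ≤ X`. Each block thus contributes at most `2^{-m/2} X`, a geometric
series. -/
lemma lintegral_rearrangement_Ioc_le {f : ℝ → ℂ} {X : ℝ≥0∞} (hX : ∀ m, dyadicBlock 2 f m ≤ X)
    (s : ℕ) :
    ∫⁻ t in Ioc (0 : ℝ) ((2 : ℝ)⁻¹ ^ s), rearrangement f t ≤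
      ((2⁻¹ : ℝ≥0∞) ^ (1 / 2 : ℝ)) ^ s * halfGeomSum * X := by
  have hterm : ∀ m, ∫⁻ t in dyadicIoc m, rearrangement f t ≤
      ((2⁻¹ : ℝ≥0∞) ^ (1 / 2 : ℝ)) ^ m * X := fun m => by
    refine (setLIntegral_dyadicIoc_le (rearrangement_antitone f) m).trans ?_
    have h := (rearrangement_pow_le f (m + 1)).trans (ENNReal.rpow_le_rpow (hX (m + 1))
      (by norm_num : (0 : ℝ) ≤ 2))
    set R := rearrangement f ((2 : ℝ)⁻¹ ^ (m + 1))
    rw [← ENNReal.rpow_le_rpow_iff (z := 2) (by norm_num), ENNReal.mul_rpow_of_nonneg _ _ (by norm_num),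
      ENNReal.mul_rpow_of_nonneg _ _ (by norm_num)]
    have e1 : ((((2⁻¹ : ℝ≥0∞) ^ (1 / 2 : ℝ)) ^ m) ^ (2 : ℝ)) = 2⁻¹ ^ m := by
      rw [← ENNReal.rpow_natCast, ← ENNReal.rpow_mul, ← ENNReal.rpow_mul, ← ENNReal.rpow_natCast]
      congr 1
      ring
    have e2 : ((2⁻¹ : ℝ≥0∞) ^ (m + 1)) ^ (2 : ℝ) = 2⁻¹ ^ m * 2⁻¹ ^ (m + 1 + 1) := by
      rw [ENNReal.rpow_ofNat, ← pow_mul, ← pow_add]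
      congr 1
      ring
    rw [e1, e2, mul_assoc]
    gcongr
  calc _ ≤ ∫⁻ t in ⋃ m, dyadicIoc (s + m), rearrangement f t :=
        lintegral_mono_set (Ioc_subset_iUnion_dyadicIoc s)
    _ ≤ ∑' m, ∫⁻ t in dyadicIoc (s + m), rearrangement f t := lintegral_iUnion_le _ _
    _ ≤ ∑' m, ((2⁻¹ : ℝ≥0∞) ^ (1 / 2 : ℝ)) ^ (s + m) * X :=
        ENNReal.tsum_le_tsum fun m => hterm _
    _ = _ := by
        simp_rw [pow_add]
        rw [ENNReal.tsum_mul_right, ENNReal.tsum_mul_left, ENNReal.tsum_geometric, halfGeomSum]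

lemma two_rpow_mul_halfPow (s : ℕ) (Y : ℝ≥0∞) :
    (2 : ℝ≥0∞) ^ s * (((2⁻¹ : ℝ≥0∞) ^ (1 / 2 : ℝ)) ^ s * Y) ^ (2 : ℝ) = Y ^ (2 : ℝ) := by
  have e1 : ((((2⁻¹ : ℝ≥0∞) ^ (1 / 2 : ℝ)) ^ s) ^ (2 : ℝ)) = 2⁻¹ ^ s := by
    rw [← ENNReal.rpow_natCast, ← ENNReal.rpow_mul, ← ENNReal.rpow_mul, ← ENNReal.rpow_natCast]
    congr 1
    ring
  rw [ENNReal.mul_rpow_of_nonneg _ _ (by norm_num), e1, ← mul_assoc, ← mul_pow,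
    ENNReal.mul_inv_cancel (by simp) (by simp), one_pow, one_mul]

/-! ### Integrability and sums of squared Fourier coefficients -/

lemma lintegral_enorm_le {f : ℝ → ℂ} (hf : AEStronglyMeasurable f unitMeasure) {X : ℝ≥0∞}
    (hX : ∀ m, dyadicBlock 2 f m ≤ X) :
    ∫⁻ x, ‖f x‖ₑ ∂unitMeasure ≤ halfGeomSum * X := by
  refine (lintegral_comp_enorm_eq hf measurable_id).trans_le ?_
  simpa using lintegral_rearrangement_Ioc_le hX 0

lemma integrable_of_dyadicBlock_le {f : ℝ → ℂ} (hf : AEStronglyMeasurable f unitMeasure)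
    {X : ℝ≥0∞} (hXt : X ≠ ∞) (hX : ∀ m, dyadicBlock 2 f m ≤ X) : Integrable f unitMeasure :=
  ⟨hf, (lintegral_enorm_le hf hX).trans_lt
    (ENNReal.mul_lt_top halfGeomSum_ne_top.lt_top hXt.lt_top)⟩

lemma integrable_mul_conj {f : ℝ → ℂ} (hf : Integrable f unitMeasure) {M : ℝ}
    {φ : Lp ℂ 2 unitMeasure} (hφ : ∀ᵐ x ∂unitMeasure, ‖φ x‖ ≤ M) :
    Integrable (fun x => f x * conj (φ x)) unitMeasure := by
  refine hf.mul_bdd (c := M) ?_ ?_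
  · exact Complex.continuous_conj.comp_aestronglyMeasurable (Lp.aestronglyMeasurable φ)
  · filter_upwards [hφ] with x hx
    simpa using hx

lemma enorm_integral_mul_conj_le {h : ℝ → ℂ} {M : ℝ} {φ : Lp ℂ 2 unitMeasure}
    (hφ : ∀ᵐ x ∂unitMeasure, ‖φ x‖ ≤ M) :
    ‖∫ x, h x * conj (φ x) ∂unitMeasure‖ₑ ≤ ENNReal.ofReal M * ∫⁻ x, ‖h x‖ₑ ∂unitMeasure := by
  refine (enorm_integral_le_lintegral_enorm _).trans ?_
  rw [← lintegral_const_mul' _ _ ENNReal.ofReal_ne_top]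
  refine lintegral_mono_ae ?_
  filter_upwards [hφ] with x hx
  rw [enorm_mul, mul_comm]
  gcongr
  rw [← ofReal_norm]
  exact ENNReal.ofReal_le_ofReal (by simpa using hx)

lemma sum_enorm_integral_mul_conj_le {φ : ℕ → Lp ℂ 2 unitMeasure} (hφ : Orthonormal ℂ φ)
    {g : ℝ → ℂ} (hg : MemLp g 2 unitMeasure) (S : Finset ℕ) :
    ∑ k ∈ S, ‖∫ x, g x * conj (φ k x) ∂unitMeasure‖ₑ ^ (2 : ℝ) ≤
      ∫⁻ x, ‖g x‖ₑ ^ (2 : ℝ) ∂unitMeasure := by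
  have hinner : ∀ k, ∫ x, g x * conj (φ k x) ∂unitMeasure = inner ℂ (φ k) hg.toLp := fun k => by
    rw [L2.inner_def]
    refine integral_congr_ae ?_
    filter_upwards [hg.coeFn_toLp] with x hx
    rw [hx, RCLike.inner_apply]
  have hnorm : ‖hg.toLp‖ₑ ^ (2 : ℝ) = ∫⁻ x, ‖g x‖ₑ ^ (2 : ℝ) ∂unitMeasure := by
    rw [Lp.enorm_toLp, eLpNorm_eq_lintegral_rpow_enorm_toReal (by simp) (by simp)]
    simp only [ENNReal.toReal_ofNat, one_div]
    rw [ENNReal.rpow_inv_rpow (by norm_num)]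
  have hB := hφ.sum_inner_products_le (s := S) hg.toLp
  rw [← hnorm]
  simp_rw [hinner, ← ofReal_norm, ENNReal.rpow_ofNat, ← ENNReal.ofReal_pow (norm_nonneg _)]
  rw [← ENNReal.ofReal_sum_of_nonneg (fun _ _ => by positivity)]
  exact ENNReal.ofReal_le_ofReal hB

/-- Truncation of `f` at the height `f^*(2^{-s})`: the bounded part. -/
lemma lintegral_truncation_le {f : ℝ → ℂ} (hf : AEStronglyMeasurable f unitMeasure) (s : ℕ) :
    ∫⁻ x, (if ‖f x‖ₑ ≤ rearrangement f ((2 : ℝ)⁻¹ ^ s) then ‖f x‖ₑ ^ (2 : ℝ) else 0) ∂unitMeasure ≤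
      ∑ m ∈ Finset.range s, dyadicBlock 2 f m ^ (2 : ℝ) + 2 * dyadicBlock 2 f s ^ (2 : ℝ) := by
  set R := rearrangement f ((2 : ℝ)⁻¹ ^ s) with hR
  have hG : Measurable fun u : ℝ≥0∞ => if u ≤ R then u ^ (2 : ℝ) else 0 :=
    Measurable.ite measurableSet_Iic (by fun_prop) measurable_const
  rw [lintegral_comp_enorm_eq hf hG]
  have h1 : (2 : ℝ)⁻¹ ^ s ≤ 1 := pow_le_one₀ (by norm_num) (by norm_num)
  have h2 : ∫⁻ t in Ioc (0 : ℝ) ((2 : ℝ)⁻¹ ^ s),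
      (if rearrangement f t ≤ R then rearrangement f t ^ (2 : ℝ) else 0) ≤
      2 * dyadicBlock 2 f s ^ (2 : ℝ) := by
    calc _ ≤ ∫⁻ t in Ioc (0 : ℝ) ((2 : ℝ)⁻¹ ^ s), R ^ (2 : ℝ) := by
          refine lintegral_mono fun t => ?_
          split_ifs with h
          · exact ENNReal.rpow_le_rpow h (by norm_num)
          · exact zero_le
      -- The factor 2 arises because block `s` is only the upper half of `(0, 2^{-s}]`.
      _ = 2 * (2⁻¹ ^ (s + 1) * R ^ (2 : ℝ)) := by
          rw [setLIntegral_const, Real.volume_Ioc, sub_zero, ENNReal.ofReal_pow (by positivity),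
            ENNReal.ofReal_inv_of_pos (by norm_num), ENNReal.ofReal_ofNat, pow_succ,
            mul_comm (_ ^ s), ← mul_assoc, ← mul_assoc,
            ENNReal.mul_inv_cancel (by simp) (by simp), one_mul, mul_comm]
      _ ≤ _ := by
          gcongr
          exact rearrangement_pow_le f s
  have h3 : ∫⁻ t in Ioc ((2 : ℝ)⁻¹ ^ s) 1,
      (if rearrangement f t ≤ R then rearrangement f t ^ (2 : ℝ) else 0) ≤
      ∑ m ∈ Finset.range s, dyadicBlock 2 f m ^ (2 : ℝ) := by
    calc _ ≤ ∫⁻ t in Ioc ((2 : ℝ)⁻¹ ^ s) 1, rearrangement f t ^ (2 : ℝ) :=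
          lintegral_mono fun t => by split_ifs <;> simp
      _ ≤ ∫⁻ t in ⋃ m ∈ Finset.range s, dyadicIoc m, rearrangement f t ^ (2 : ℝ) :=
          lintegral_mono_set (Ioc_subset_biUnion_dyadicIoc s)
      _ ≤ _ := by
          simp_rw [dyadicBlock_rpow]
          exact lintegral_biUnion_finset_le' _ _ _
  rw [← Ioc_union_Ioc_eq_Ioc (by positivity : (0 : ℝ) ≤ (2 : ℝ)⁻¹ ^ s) h1]
  exact (lintegral_union_le _ _ _).trans ((add_le_add h2 h3).trans (add_comm _ _).le)

/-- Truncation of `f` at the height `f^*(2^{-s})`: the integrable part. -/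
lemma lintegral_truncation_compl_le {f : ℝ → ℂ} (hf : AEStronglyMeasurable f unitMeasure) (s : ℕ) :
    ∫⁻ x, (if ‖f x‖ₑ ≤ rearrangement f ((2 : ℝ)⁻¹ ^ s) then 0 else ‖f x‖ₑ) ∂unitMeasure ≤
      ∫⁻ t in Ioc (0 : ℝ) ((2 : ℝ)⁻¹ ^ s), rearrangement f t := by
  set R := rearrangement f ((2 : ℝ)⁻¹ ^ s) with hR
  have hG : Measurable fun u : ℝ≥0∞ => if u ≤ R then 0 else u :=
    Measurable.ite measurableSet_Iic measurable_const measurable_id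
  rw [lintegral_comp_enorm_eq hf hG]
  have h1 : (2 : ℝ)⁻¹ ^ s ≤ 1 := pow_le_one₀ (by norm_num) (by norm_num)
  rw [← Ioc_union_Ioc_eq_Ioc (by positivity : (0 : ℝ) ≤ (2 : ℝ)⁻¹ ^ s) h1]
  refine (lintegral_union_le _ _ _).trans ?_
  have h0 : ∫⁻ t in Ioc ((2 : ℝ)⁻¹ ^ s) 1,
      (if rearrangement f t ≤ R then 0 else rearrangement f t) = 0 := by
    rw [setLIntegral_congr_fun (g := fun _ => 0) measurableSet_Ioc, lintegral_zero]
    intro t ht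
    exact if_pos (rearrangement_antitone f ht.1.le)
  rw [h0, add_zero]
  exact lintegral_mono fun t => by split_ifs <;> simp

/-- The cut height depends on `s`, the logarithm of the number of indices: it balances Bessel for
the square-integrable part against the uniform bound for the rest. -/
lemma sum_sq_coeff_le {φ : ℕ → Lp ℂ 2 unitMeasure} (hφ : Orthonormal ℂ φ) {M : ℝ}
    (hM : ∀ k, ∀ᵐ x ∂unitMeasure, ‖φ k x‖ ≤ M) {f : ℝ → ℂ}
    (hf : AEStronglyMeasurable f unitMeasure) {X : ℝ≥0∞} (hXt : X ≠ ∞)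
    (hX : ∀ m, dyadicBlock 2 f m ≤ X) (s : ℕ) {S : Finset ℕ} (hS : S.card = 2 ^ s) :
    ∑ k ∈ S, ‖coeff φ f k‖ₑ ^ (2 : ℝ) ≤
      2 * (∑ m ∈ Finset.range s, dyadicBlock 2 f m ^ (2 : ℝ) + 2 * X ^ (2 : ℝ) +
        (ENNReal.ofReal M * halfGeomSum * X) ^ (2 : ℝ)) := by
  set R := rearrangement f ((2 : ℝ)⁻¹ ^ s) with hR
  set g : ℝ → ℂ := fun x => if ‖f x‖ₑ ≤ R then f x else 0 with hg
  set h : ℝ → ℂ := fun x => if ‖f x‖ₑ ≤ R then 0 else f x with hh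
  have hset : MeasurableSet {z : ℂ | ‖z‖ₑ ≤ R} := measurableSet_le measurable_enorm measurable_const
  have hgm : AEStronglyMeasurable g unitMeasure :=
    ((Measurable.ite hset measurable_id measurable_const).comp_aemeasurable
      hf.aemeasurable).aestronglyMeasurable
  have hgh : ∀ x, f x = g x + h x := fun x => by simp only [hg, hh]; split_ifs <;> simp
  have hg2 : ∫⁻ x, ‖g x‖ₑ ^ (2 : ℝ) ∂unitMeasure ≤
      ∑ m ∈ Finset.range s, dyadicBlock 2 f m ^ (2 : ℝ) + 2 * X ^ (2 : ℝ) := by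
    have e : ∀ x, ‖g x‖ₑ ^ (2 : ℝ) = if ‖f x‖ₑ ≤ R then ‖f x‖ₑ ^ (2 : ℝ) else 0 := fun x => by
      simp only [hg]; split_ifs <;> simp
    simp_rw [e]
    refine (lintegral_truncation_le hf s).trans ?_
    gcongr
    exact hX s
  have hh1 : ∫⁻ x, ‖h x‖ₑ ∂unitMeasure ≤
      ((2⁻¹ : ℝ≥0∞) ^ (1 / 2 : ℝ)) ^ s * halfGeomSum * X := by
    have e : ∀ x, ‖h x‖ₑ = if ‖f x‖ₑ ≤ R then 0 else ‖f x‖ₑ := fun x => by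
      simp only [hh]; split_ifs <;> simp
    simp_rw [e]
    exact (lintegral_truncation_compl_le hf s).trans (lintegral_rearrangement_Ioc_le hX s)
  have hfi := integrable_of_dyadicBlock_le hf hXt hX
  have hgL : MemLp g 2 unitMeasure := by
    refine ⟨hgm, ?_⟩
    rw [eLpNorm_lt_top_iff_lintegral_rpow_enorm_lt_top (by simp) (by simp)]
    simp only [ENNReal.toReal_ofNat]
    refine hg2.trans_lt (ENNReal.add_lt_top.mpr ⟨ENNReal.sum_lt_top.mpr fun m _ => ?_, ?_⟩)
    · exact ENNReal.rpow_lt_top_of_nonneg (by norm_num) (ne_top_of_le_ne_top hXt (hX m))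
    · exact ENNReal.mul_lt_top (by simp) (ENNReal.rpow_lt_top_of_nonneg (by norm_num) hXt)
  have hgi : Integrable g unitMeasure := hgL.integrable (by norm_num)
  have hhi : Integrable h unitMeasure := by
    have : h = fun x => f x - g x := by ext x; rw [hgh x]; ring
    rw [this]
    exact hfi.sub hgi
  have hsplit : ∀ k, coeff φ f k = ∫ x, g x * conj (φ k x) ∂unitMeasure +
      ∫ x, h x * conj (φ k x) ∂unitMeasure := fun k => by
    rw [coeff, ← integral_add (integrable_mul_conj hgi (hM k)) (integrable_mul_conj hhi (hM k))]
    congr 1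
    ext x
    rw [hgh x, add_mul]
  calc ∑ k ∈ S, ‖coeff φ f k‖ₑ ^ (2 : ℝ)
      ≤ ∑ k ∈ S, 2 * (‖∫ x, g x * conj (φ k x) ∂unitMeasure‖ₑ ^ (2 : ℝ) +
          (((2⁻¹ : ℝ≥0∞) ^ (1 / 2 : ℝ)) ^ s * (ENNReal.ofReal M * halfGeomSum * X)) ^ (2 : ℝ)) := by
        refine Finset.sum_le_sum fun k _ => ?_
        rw [hsplit]
        have hd : ‖∫ x, h x * conj (φ k x) ∂unitMeasure‖ₑ ≤
            ((2⁻¹ : ℝ≥0∞) ^ (1 / 2 : ℝ)) ^ s * (ENNReal.ofReal M * halfGeomSum * X) :=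
          (enorm_integral_mul_conj_le (hM k)).trans
            ((mul_le_mul_right hh1 _).trans (by ring_nf; rfl))
        refine (ENNReal.rpow_le_rpow (enorm_add_le _ _) (by norm_num)).trans ?_
        refine (ENNReal.rpow_add_le_mul_rpow_add_rpow _ _ (by norm_num)).trans ?_
        norm_num only
        rw [ENNReal.rpow_one]
        gcongr
    _ = 2 * (∑ k ∈ S, ‖∫ x, g x * conj (φ k x) ∂unitMeasure‖ₑ ^ (2 : ℝ) +
          (ENNReal.ofReal M * halfGeomSum * X) ^ (2 : ℝ)) := by
        rw [← Finset.mul_sum, Finset.sum_add_distrib, Finset.sum_const, hS, nsmul_eq_mul,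
          Nat.cast_pow, Nat.cast_ofNat, two_rpow_mul_halfPow]
    _ ≤ _ := by
        gcongr
        exact (sum_enorm_integral_mul_conj_le hφ hgL S).trans hg2

/-! ### The estimate in `L_{2,q,τ}` -/

lemma quadraticMean_antitone {b : ℕ → ℝ≥0∞} (hb : Antitone b) {k s : ℕ} (hk : 1 ≤ k)
    (hks : k ≤ s) : quadraticMean b s ≤ quadraticMean b k := by
  induction s, hks using Nat.le_induction with
  | base => exact le_rfl
  | succ s hks ih =>
    refine le_trans (ENNReal.rpow_le_rpow ?_ (by norm_num)) ih
    have hs0 : (s : ℝ≥0∞) ≠ 0 := by exact_mod_cast (by omega : s ≠ 0)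
    set T := (s : ℝ≥0∞)⁻¹ * ∑ j ∈ Finset.range s, b (j + 1) ^ (2 : ℝ) with hT
    have hsum : ∑ j ∈ Finset.range s, b (j + 1) ^ (2 : ℝ) = s * T := by
      rw [hT, ← mul_assoc, ENNReal.mul_inv_cancel hs0 (ENNReal.natCast_ne_top s), one_mul]
    have hle : b (s + 1) ^ (2 : ℝ) ≤ T := by
      rw [hT, mul_comm, ← div_eq_mul_inv,
        ENNReal.le_div_iff_mul_le (Or.inl hs0) (Or.inl (ENNReal.natCast_ne_top s)), mul_comm]
      have := Finset.card_nsmul_le_sum (Finset.range s) (fun j => b (j + 1) ^ (2 : ℝ))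
        (b (s + 1) ^ (2 : ℝ)) fun j hj => ENNReal.rpow_le_rpow
          (hb (by have := Finset.mem_range.mp hj; omega)) (by norm_num)
      simpa using this
    rw [Finset.sum_range_succ, hsum]
    calc ((s + 1 : ℕ) : ℝ≥0∞)⁻¹ * (s * T + b (s + 1) ^ (2 : ℝ))
        ≤ ((s + 1 : ℕ) : ℝ≥0∞)⁻¹ * (s * T + T) := by gcongr
      _ = ((s + 1 : ℕ) : ℝ≥0∞)⁻¹ * ((s + 1 : ℕ) : ℝ≥0∞) * T := by push_cast; ring
      _ = T := by
        rw [ENNReal.inv_mul_cancel (by simp) (ENNReal.natCast_ne_top _), one_mul]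

lemma sum_Icc_one_eq_sum_range (n : ℕ) (F : ℕ → ℝ≥0∞) :
    ∑ m ∈ Finset.Icc 1 n, F m = ∑ j ∈ Finset.range n, F (j + 1) := by
  rw [Finset.range_eq_Ico, Finset.sum_Ico_add' F 0 n 1]
  rfl

lemma exists_dyadicSup_coeff_le (M : ℝ) :
    ∃ C : ℝ≥0, ∀ φ : ℕ → Lp ℂ 2 unitMeasure, Orthonormal ℂ φ →
      (∀ k, ∀ᵐ x ∂unitMeasure, ‖φ k x‖ ≤ M) →
      ∀ f : ℝ → ℂ, AEStronglyMeasurable f unitMeasure →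
      seqRearrangement (dyadicBlock 2 f) 1 ≠ ∞ → ∀ k,
        dyadicSup 2 (coeff φ f) (k + 1) ≤
          C * quadraticMean (seqRearrangement (dyadicBlock 2 f)) (k + 1) := by
  -- Here `8 = 4 · 2`: the 4 undoes the halved rearrangement, the 2 comes from squaring `g + h`. The
  -- `3 = 1 + 2` collects the two contributions to `‖g‖_2²`.
  set D : ℝ≥0∞ := 8 * (3 + (ENNReal.ofReal M * halfGeomSum) ^ (2 : ℝ)) with hD
  have hDt : D ≠ ∞ := by
    refine ENNReal.mul_ne_top (by simp) (ENNReal.add_ne_top.mpr ⟨by simp, ?_⟩)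
    exact ENNReal.rpow_ne_top_of_nonneg (by norm_num)
      (ENNReal.mul_ne_top ENNReal.ofReal_ne_top halfGeomSum_ne_top)
  refine ⟨(D ^ (1 / 2 : ℝ)).toNNReal, fun φ hφ hM f hf hXt k => ?_⟩
  rw [ENNReal.coe_toNNReal (ENNReal.rpow_ne_top_of_nonneg (by norm_num) hDt)]
  set b := seqRearrangement (dyadicBlock 2 f) with hb
  have hX : ∀ m, dyadicBlock 2 f m ≤ b 1 := le_seqRearrangement_one _
  have hcoeff : ∀ k, ‖coeff φ f k‖ₑ ≤ ENNReal.ofReal M * (halfGeomSum * b 1) := fun k =>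
    (enorm_integral_mul_conj_le (hM k)).trans (mul_le_mul_right (lintegral_enorm_le hf hX) _)
  have hct : ENNReal.ofReal M * (halfGeomSum * b 1) ≠ ∞ :=
    ENNReal.mul_ne_top ENNReal.ofReal_ne_top (ENNReal.mul_ne_top halfGeomSum_ne_top hXt)
  refine iSup₂_le fun s hs => ?_
  obtain ⟨hs1, hks⟩ := hs
  refine le_trans ?_ (mul_le_mul_right
    (quadraticMean_antitone (seqRearrangement_antitone (dyadicBlock 2 f)) (by omega) hks) _)
  obtain ⟨S, hS, hle⟩ := exists_finset_sum_seqRearrangement_le hct hcoeff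
    (p := 2) (by norm_num) (2 ^ s)
  set Q := ∑ j ∈ Finset.range s, b (j + 1) ^ (2 : ℝ) with hQ
  -- Since `s ≥ 1`, the supremum of the blocks is itself a term of `Q`, so all `sup ξ` errors are
  -- absorbed.
  have hb1 : b 1 ^ (2 : ℝ) ≤ Q :=
    Finset.single_le_sum (f := fun j => b (j + 1) ^ (2 : ℝ)) (fun _ _ => zero_le)
      (Finset.mem_range.mpr (by omega : 0 < s))
  have hsum : ∑ m ∈ Finset.Icc 1 (2 ^ s), coeffRearrangement (coeff φ f) m ^ (2 : ℝ) ≤ D * Q := by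
    rw [sum_Icc_one_eq_sum_range]
    calc _ = 4 * ∑ j ∈ Finset.range (2 ^ s),
          (2⁻¹ * coeffRearrangement (coeff φ f) (j + 1)) ^ (2 : ℝ) := by
          rw [Finset.mul_sum]
          refine Finset.sum_congr rfl fun j _ => ?_
          rw [ENNReal.mul_rpow_of_nonneg _ _ (by norm_num), ← mul_assoc,
            show (4 : ℝ≥0∞) = 2 ^ (2 : ℝ) by norm_num, ← ENNReal.mul_rpow_of_nonneg _ _ (by norm_num),
            ENNReal.mul_inv_cancel (by simp) (by simp), ENNReal.one_rpow, one_mul]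
      _ ≤ 4 * (2 * (∑ m ∈ Finset.range s, dyadicBlock 2 f m ^ (2 : ℝ) + 2 * b 1 ^ (2 : ℝ) +
            (ENNReal.ofReal M * halfGeomSum * b 1) ^ (2 : ℝ))) := by
          gcongr
          exact hle.trans (sum_sq_coeff_le hφ hM hf hXt hX s hS)
      _ ≤ 4 * (2 * (Q + 2 * Q + (ENNReal.ofReal M * halfGeomSum) ^ (2 : ℝ) * Q)) := by
          rw [ENNReal.mul_rpow_of_nonneg (_ * halfGeomSum) _ (by norm_num)]
          gcongr
          exact sum_rpow_le_sum_seqRearrangement _ (by norm_num) s _ (Finset.card_range s)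
      _ = D * Q := by rw [hD]; ring
  rw [quadraticMean, ← ENNReal.mul_rpow_of_nonneg _ _ (by norm_num)]
  refine ENNReal.rpow_le_rpow ?_ (by norm_num)
  refine (mul_le_mul_right hsum _).trans (le_of_eq ?_)
  ring

/-- The term `k = 1` carries weight one. Applied to `ξ^*`, this bounds all blocks and makes `f`
integrable. -/
lemma seqRearrangement_one_ne_top_of_lorentzSeq_lt_top {q τ : ℝ≥0∞} (hτ : 0 < τ) {b : ℕ → ℝ≥0∞}
    (h : lorentzSeq q τ b < ∞) : b 1 ≠ ∞ := by
  rcases eq_or_ne τ ∞ with rfl | hτt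
  · simp only [lorentzSeq, if_true] at h
    have := (le_iSup (fun k : ℕ => ((k + 1 : ℕ) : ℝ≥0∞) ^ (1 / q.toReal) * b (k + 1)) 0).trans_lt h
    simpa using this.ne
  · have hr : 0 < τ.toReal := ENNReal.toReal_pos hτ.ne' hτt
    simp only [lorentzSeq, if_neg hτt] at h
    rw [ENNReal.rpow_lt_top_iff_of_pos (by positivity)] at h
    have := (ENNReal.le_tsum (f := fun k : ℕ => (((k + 1 : ℕ) : ℝ≥0∞) ^ (1 / q.toReal) *
      b (k + 1)) ^ τ.toReal * ((k + 1 : ℕ) : ℝ≥0∞)⁻¹) 0).trans_lt h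
    simp only [zero_add, Nat.cast_one, ENNReal.one_rpow, one_mul, inv_one, mul_one] at this
    exact ((ENNReal.rpow_lt_top_iff_of_pos hr).mp this).ne

theorem exists_lambdaNorm_coeff_le {q : ℝ≥0∞} (hq : 2 < q) {τ : ℝ≥0∞} (hτ : 0 < τ) (M : ℝ) :
    ∃ C : ℝ≥0, ∀ φ : ℕ → Lp ℂ 2 unitMeasure, Orthonormal ℂ φ →
      (∀ k, ∀ᵐ x ∂unitMeasure, ‖φ k x‖ ≤ M) →
      ∀ f : ℝ → ℂ, AEStronglyMeasurable f unitMeasure → lorentzNorm₃ 2 q τ f < ∞ →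
        (∀ k, Integrable (fun x => f x * conj (φ k x)) unitMeasure) ∧
        lambdaNorm 2 q τ (coeff φ f) ≤ C * lorentzNorm₃ 2 q τ f := by
  obtain ⟨K, hK⟩ := exists_dyadicSup_coeff_le M
  obtain ⟨C, hC⟩ := exists_lorentzSeq_le_of_le_quadraticMean hq hτ K
  refine ⟨C, fun φ hφ hM f hf hfin => ?_⟩
  have hXt := seqRearrangement_one_ne_top_of_lorentzSeq_lt_top hτ hfin
  refine ⟨fun k => integrable_mul_conj (integrable_of_dyadicBlock_le hf hXt
    (le_seqRearrangement_one _)) (hM k), ?_⟩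
  exact hC _ _ (seqRearrangement_antitone _) (hK φ hφ hM f hf hXt)

/-! ### The diagonal case -/

lemma lorentzSeq_top_top (b : ℕ → ℝ≥0∞) : lorentzSeq ∞ ∞ b = ⨆ k, b (k + 1) := by
  simp [lorentzSeq]

lemma lorentzSeq_self {q : ℝ≥0∞} (hq : 0 < q) (hqt : q ≠ ∞) (b : ℕ → ℝ≥0∞) :
    lorentzSeq q q b = (∑' k, b (k + 1) ^ q.toReal) ^ (1 / q.toReal) := by
  have hr : 0 < q.toReal := ENNReal.toReal_pos hq.ne' hqt
  rw [lorentzSeq, if_neg hqt]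
  congr 2
  ext k
  rw [ENNReal.mul_rpow_of_nonneg _ _ hr.le, one_div, ENNReal.rpow_inv_rpow hr.ne', mul_right_comm,
    ENNReal.mul_inv_cancel (by simp) (ENNReal.natCast_ne_top _), one_mul]

lemma tsum_seqRearrangement_rpow_le (b : ℕ → ℝ≥0∞) {r : ℝ} (hr : 0 < r) :
    ∑' k, seqRearrangement b (k + 1) ^ r ≤ 2 ^ r * ∑' m, b m ^ r := by
  rcases eq_or_ne (∑' m, b m ^ r) ∞ with htop | htop
  · rw [htop, ENNReal.mul_top (by positivity)]
    exact le_top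
  have hb : ∀ m, b m ≤ (∑' m, b m ^ r) ^ r⁻¹ := fun m =>
    (ENNReal.le_rpow_inv_iff hr).mpr (ENNReal.le_tsum (f := fun m => b m ^ r) m)
  refine ENNReal.tsum_le_of_sum_range_le fun n => ?_
  obtain ⟨S, -, hS⟩ := exists_finset_sum_seqRearrangement_le
    (ENNReal.rpow_ne_top_of_nonneg (by positivity) htop) hb hr.le n
  calc _ = 2 ^ r * ∑ k ∈ Finset.range n, (2⁻¹ * seqRearrangement b (k + 1)) ^ r := by
        rw [Finset.mul_sum]
        refine Finset.sum_congr rfl fun j _ => ?_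
        rw [← ENNReal.mul_rpow_of_nonneg _ _ hr.le, ← mul_assoc,
          ENNReal.mul_inv_cancel (by simp) (by simp), one_mul]
    _ ≤ _ := mul_le_mul_right (hS.trans (ENNReal.sum_le_tsum S)) _

lemma dyadicBlock_le (f : ℝ → ℂ) (m : ℕ) :
    dyadicBlock 2 f m ≤
      ((2⁻¹ : ℝ≥0∞) ^ (m + 1)) ^ (1 / 2 : ℝ) * rearrangement f ((2 : ℝ)⁻¹ ^ (m + 1)) := by
  rw [← ENNReal.rpow_le_rpow_iff (z := 2) (by norm_num), dyadicBlock_rpow,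
    ENNReal.mul_rpow_of_nonneg _ _ (by norm_num), one_div, ENNReal.rpow_inv_rpow (by norm_num)]
  exact setLIntegral_dyadicIoc_le (rearrangement_rpow_antitone f (by norm_num)) m

lemma ofReal_half_pow (m : ℕ) : ENNReal.ofReal ((2 : ℝ)⁻¹ ^ m) = 2⁻¹ ^ m := by
  rw [ENNReal.ofReal_pow (by positivity), ENNReal.ofReal_inv_of_pos (by norm_num),
    ENNReal.ofReal_ofNat]

/-- The block is compared with the next one, where `f^*` is at least `f^*(2^{-m-1})`. The constant
`2^{1/2}` is the loss in `t^{1/2}`, and 2 compensates for the lower bound `1/2` on the `dt/t` mass.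
-/
lemma dyadicBlock_rpow_le (f : ℝ → ℂ) {r : ℝ} (hr : 0 ≤ r) (m : ℕ) :
    dyadicBlock 2 f m ^ r ≤ ((2 : ℝ≥0∞) ^ (1 / 2 : ℝ)) ^ r * 2 * ∫⁻ t in dyadicIoc (m + 1),
      (ENNReal.ofReal t ^ (1 / 2 : ℝ) * rearrangement f t) ^ r * ENNReal.ofReal t⁻¹ := by
  set R := rearrangement f ((2 : ℝ)⁻¹ ^ (m + 1)) with hR
  set Y : ℝ≥0∞ := ((2⁻¹ : ℝ≥0∞) ^ (m + 1 + 1)) ^ (1 / 2 : ℝ) * R with hY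
  have h1 : Y ^ r * 2 ^ (m + 1) * 2⁻¹ ^ (m + 1 + 1) ≤ ∫⁻ t in dyadicIoc (m + 1),
      (ENNReal.ofReal t ^ (1 / 2 : ℝ) * rearrangement f t) ^ r * ENNReal.ofReal t⁻¹ := by
    rw [← volume_dyadicIoc, ← setLIntegral_const]
    refine setLIntegral_mono' measurableSet_Ioc fun t ht => ?_
    have ht0 : 0 < t := lt_trans (by positivity) ht.1
    refine mul_le_mul' (ENNReal.rpow_le_rpow (mul_le_mul' (ENNReal.rpow_le_rpow ?_ (by norm_num))
      (rearrangement_antitone f ht.2)) hr) ?_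
    · rw [← ofReal_half_pow]
      exact ENNReal.ofReal_le_ofReal ht.1.le
    · have : (2 : ℝ) ^ (m + 1) ≤ t⁻¹ := by
        rw [le_inv_comm₀ (by positivity) ht0, ← inv_pow]
        exact ht.2
      refine le_trans (le_of_eq ?_) (ENNReal.ofReal_le_ofReal this)
      rw [ENNReal.ofReal_pow (by norm_num), ENNReal.ofReal_ofNat]
  have h2 : Y ^ r * 2 ^ (m + 1) * 2⁻¹ ^ (m + 1 + 1) = Y ^ r * 2⁻¹ := by
    rw [pow_succ 2⁻¹ (m + 1), mul_assoc, ← mul_assoc (2 ^ (m + 1)), ← mul_pow,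
      ENNReal.mul_inv_cancel (by simp) (by simp), one_pow, one_mul]
  have h3 : ((2⁻¹ : ℝ≥0∞) ^ (m + 1)) ^ (1 / 2 : ℝ) * R = (2 : ℝ≥0∞) ^ (1 / 2 : ℝ) * Y := by
    rw [hY, ← mul_assoc, ← ENNReal.mul_rpow_of_nonneg _ _ (by norm_num), pow_succ 2⁻¹ (m + 1),
      mul_comm (2⁻¹ ^ (m + 1)), ← mul_assoc, ENNReal.mul_inv_cancel (by simp) (by simp), one_mul]
  calc dyadicBlock 2 f m ^ r ≤ ((2 : ℝ≥0∞) ^ (1 / 2 : ℝ) * Y) ^ r := by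
        rw [← h3]; exact ENNReal.rpow_le_rpow (dyadicBlock_le f m) hr
    _ = ((2 : ℝ≥0∞) ^ (1 / 2 : ℝ)) ^ r * 2 * (Y ^ r * 2⁻¹) := by
        rw [ENNReal.mul_rpow_of_nonneg _ _ hr, mul_assoc, mul_comm (Y ^ r), ← mul_assoc 2,
          ENNReal.mul_inv_cancel (by simp) (by simp), one_mul]
    _ ≤ _ := by rw [← h2]; gcongr

lemma tsum_setLIntegral_dyadicIoc_le (G : ℝ → ℝ≥0∞) :
    ∑' m, ∫⁻ t in dyadicIoc (m + 1), G t ≤ ∫⁻ t in Ioc (0 : ℝ) 1, G t := by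
  have hanti : Antitone fun m : ℕ => (2 : ℝ)⁻¹ ^ (m + 1) := fun m n hmn =>
    pow_le_pow_of_le_one (by norm_num) (by norm_num) (by omega)
  rw [← lintegral_iUnion (s := fun m => dyadicIoc (m + 1)) (fun _ => measurableSet_Ioc)
    hanti.pairwise_disjoint_on_Ioc_succ]
  refine lintegral_mono_set (iUnion_subset fun m => Ioc_subset_Ioc (by positivity) ?_)
  exact pow_le_one₀ (by norm_num) (by norm_num)

lemma exists_lorentzNorm₃_self_le {q : ℝ≥0∞} (hq : 0 < q) :
    ∃ C : ℝ≥0, ∀ f : ℝ → ℂ, lorentzNorm₃ 2 q q f ≤ C * lorentzNorm 2 q f := by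
  rcases eq_or_ne q ∞ with rfl | hqt
  · refine ⟨1, fun f => ?_⟩
    rw [lorentzNorm₃, lorentzSeq_top_top, lorentzNorm, if_pos rfl, ENNReal.coe_one, one_mul]
    refine iSup_le fun k => seqRearrangement_le_of_forall_le (fun m => ?_) (by omega)
    refine (dyadicBlock_le f m).trans ?_
    rw [← ofReal_half_pow]
    exact le_iSup₂_of_le (f := fun t (_ : t ∈ Ioc (0 : ℝ) 1) =>
      ENNReal.ofReal t ^ (1 / 2 : ℝ) * rearrangement f t) _
      ⟨by positivity, pow_le_one₀ (by norm_num) (by norm_num)⟩ le_rfl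
  · have hr : 0 < q.toReal := ENNReal.toReal_pos hq.ne' hqt
    set r := q.toReal with hrdef
    set D : ℝ≥0∞ := 2 ^ r * (((2 : ℝ≥0∞) ^ (1 / 2 : ℝ)) ^ r * 2) with hD
    have hDt : D ≠ ∞ := by
      refine ENNReal.mul_ne_top (ENNReal.rpow_ne_top_of_nonneg hr.le (by simp))
        (ENNReal.mul_ne_top (ENNReal.rpow_ne_top_of_nonneg hr.le
          (ENNReal.rpow_ne_top_of_nonneg (by norm_num) (by simp))) (by simp))
    refine ⟨(D ^ (1 / r)).toNNReal, fun f => ?_⟩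
    rw [ENNReal.coe_toNNReal (ENNReal.rpow_ne_top_of_nonneg (by positivity) hDt), lorentzNorm₃,
      lorentzSeq_self hq hqt, lorentzNorm, if_neg hqt, ← ENNReal.mul_rpow_of_nonneg _ _ (by positivity)]
    refine ENNReal.rpow_le_rpow ?_ (by positivity)
    refine (tsum_seqRearrangement_rpow_le _ hr).trans ?_
    rw [hD, mul_assoc]
    refine mul_le_mul_right ?_ _
    refine (ENNReal.tsum_le_tsum fun m => dyadicBlock_rpow_le f hr.le m).trans ?_
    rw [ENNReal.tsum_mul_left]
    gcongr
    exact tsum_setLIntegral_dyadicIoc_le _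

lemma dyadicSup_zero (p : ℝ) (a : ℕ → ℂ) : dyadicSup p a 0 = dyadicSup p a 1 := by
  simp [dyadicSup]

lemma exists_dyadicLowerBound_le {q : ℝ≥0∞} (hq : 0 < q) :
    ∃ C : ℝ≥0, ∀ a : ℕ → ℂ, dyadicLowerBound q a ≤ C * lambdaNorm 2 q q a := by
  rcases eq_or_ne q ∞ with rfl | hqt
  · refine ⟨1, fun a => ?_⟩
    rw [lambdaNorm, lorentzSeq_top_top, dyadicLowerBound, if_pos rfl, ENNReal.coe_one, one_mul]
    refine iSup_le fun k => ?_
    rcases k with _ | k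
    · rw [dyadicSup_zero]
      exact le_iSup (fun k => dyadicSup 2 a (k + 1)) 0
    · exact le_iSup (fun k => dyadicSup 2 a (k + 1)) k
  · have hr : 0 < q.toReal := ENNReal.toReal_pos hq.ne' hqt
    set r := q.toReal with hrdef
    refine ⟨2 ^ (1 / r), fun a => ?_⟩
    rw [lambdaNorm, lorentzSeq_self hq hqt, dyadicLowerBound, if_neg hqt,
      ENNReal.coe_rpow_of_nonneg _ (by positivity), ← ENNReal.mul_rpow_of_nonneg _ _ (by positivity)]
    refine ENNReal.rpow_le_rpow ?_ (by positivity)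
    -- The term `k = 0` repeats the term `k = 1`, hence the factor 2.
    rw [tsum_eq_zero_add' ENNReal.summable, dyadicSup_zero, ENNReal.coe_ofNat, two_mul]
    gcongr
    exact ENNReal.le_tsum (f := fun k => dyadicSup 2 a (k + 1) ^ r) 0

/-! ### The logarithmic lower bound -/

lemma logAverage_le {n s : ℕ} (hs : 1 ≤ s) (hn : 2 ^ (s - 1) ≤ n) (hn' : n ≤ 2 ^ s) (a : ℕ → ℂ) :
    logAverage a n ≤ ENNReal.ofReal (Real.log 2 / 2) ^ (-(1 / 2) : ℝ) * dyadicSup 2 a s := by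
  have hl2 : 0 < Real.log 2 := Real.log_pos (by norm_num)
  have hlog : Real.log 2 / 2 * s ≤ Real.log (n + 1) := by
    have hn1 : (2 : ℝ) ^ (s - 1) ≤ n := by exact_mod_cast hn
    -- The bound `s ≤ 2(s - 1)` fails at `s = 1`; there the `+ 1` inside the logarithm is needed.
    rcases eq_or_lt_of_le hs with rfl | h2
    · have : Real.log 2 ≤ Real.log (n + 1) :=
        Real.log_le_log (by norm_num) (by rw [Nat.sub_self, pow_zero] at hn1; linarith)
      norm_num
      linarith
    · have h3 : ((s - 1 : ℕ) : ℝ) * Real.log 2 ≤ Real.log (n + 1) := by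
        rw [← Real.log_pow]
        exact Real.log_le_log (by positivity) (by linarith)
      have h4 : (s : ℝ) ≤ 2 * ((s - 1 : ℕ) : ℝ) := by exact_mod_cast (by omega)
      nlinarith
  have hsum : ((s : ℝ≥0∞)⁻¹ * ∑ m ∈ Finset.Icc 1 (2 ^ s), coeffRearrangement a m ^ (2 : ℝ))
      ^ (1 / 2 : ℝ) ≤ dyadicSup 2 a s :=
    le_iSup₂_of_le (f := fun s' (_ : 1 ≤ s' ∧ s ≤ s') => ((s' : ℝ≥0∞)⁻¹ *
      ∑ m ∈ Finset.Icc 1 (2 ^ s'), coeffRearrangement a m ^ (2 : ℝ)) ^ (1 / 2 : ℝ))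
      s ⟨hs, le_rfl⟩ le_rfl
  refine le_trans ?_ (mul_le_mul_right hsum _)
  rw [ENNReal.mul_rpow_of_nonneg _ _ (by norm_num), ← mul_assoc, ENNReal.inv_rpow,
    ← ENNReal.rpow_neg, ← ENNReal.mul_rpow_of_ne_top ENNReal.ofReal_ne_top
      (ENNReal.natCast_ne_top s), ← ENNReal.ofReal_natCast, ← ENNReal.ofReal_mul (by positivity),
    logAverage]
  refine mul_le_mul' ?_ (ENNReal.rpow_le_rpow (Finset.sum_le_sum_of_subset
    (Finset.Icc_subset_Icc le_rfl hn')) (by norm_num))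
  rw [ENNReal.rpow_neg, ENNReal.rpow_neg, ENNReal.inv_le_inv]
  exact ENNReal.rpow_le_rpow (ENNReal.ofReal_le_ofReal hlog) (by norm_num)

/-- Each dyadic block has `2^N` indices of weight at most `2^{-N}`, so it contributes at most `v N`.
-/
lemma sum_range_two_pow_le {u v : ℕ → ℝ≥0∞}
    (h : ∀ s n : ℕ, 2 ^ s ≤ n + 1 → n + 1 < 2 ^ (s + 1) → u n ≤ v s) (N : ℕ) :
    ∑ n ∈ Finset.range (2 ^ N - 1), ((n + 1 : ℕ) : ℝ≥0∞)⁻¹ * u n ≤ ∑ s ∈ Finset.range N, v s := by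
  induction N with
  | zero => simp
  | succ N ih =>
    have hpos : 1 ≤ 2 ^ N := Nat.one_le_two_pow
    have hle : 2 ^ N - 1 ≤ 2 ^ (N + 1) - 1 := by rw [pow_succ]; omega
    rw [← Finset.sum_range_add_sum_Ico _ hle, Finset.sum_range_succ]
    refine add_le_add ih ?_
    calc _ ≤ ∑ n ∈ Finset.Ico (2 ^ N - 1) (2 ^ (N + 1) - 1), ((2 : ℝ≥0∞) ^ N)⁻¹ * v N := by
          refine Finset.sum_le_sum fun n hn => ?_
          rw [Finset.mem_Ico] at hn
          refine mul_le_mul' (ENNReal.inv_le_inv.mpr ?_) (h N n (by omega) (by omega))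
          exact_mod_cast (by omega : 2 ^ N ≤ n + 1)
      _ = v N := by
          rw [Finset.sum_const, Nat.card_Ico,
            show 2 ^ (N + 1) - 1 - (2 ^ N - 1) = 2 ^ N by rw [pow_succ]; omega, nsmul_eq_mul,
            ← mul_assoc]
          push_cast
          rw [ENNReal.mul_inv_cancel (by simp) (by simp), one_mul]

lemma tsum_inv_mul_le {u v : ℕ → ℝ≥0∞}
    (h : ∀ s n : ℕ, 2 ^ s ≤ n + 1 → n + 1 < 2 ^ (s + 1) → u n ≤ v s) :
    ∑' n : ℕ, ((n + 1 : ℕ) : ℝ≥0∞)⁻¹ * u n ≤ ∑' s, v s := by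
  refine ENNReal.tsum_le_of_sum_range_le fun n => ?_
  refine le_trans (Finset.sum_le_sum_of_subset (Finset.range_mono ?_))
    ((sum_range_two_pow_le h n).trans (ENNReal.sum_le_tsum _))
  have := Nat.lt_two_pow_self (n := n)
  omega

theorem exists_logLowerBound_le {q : ℝ≥0∞} (hq : 0 < q) :
    ∃ C : ℝ≥0, ∀ a : ℕ → ℂ, logLowerBound q a ≤ C * dyadicLowerBound q a := by
  set D : ℝ≥0∞ := ENNReal.ofReal (Real.log 2 / 2) ^ (-(1 / 2) : ℝ) with hD
  have hDt : D ≠ ∞ := by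
    have : 0 < Real.log 2 / 2 := by have := Real.log_pos (x := 2) (by norm_num); positivity
    rw [hD, ENNReal.ofReal_rpow_of_pos this]
    exact ENNReal.ofReal_ne_top
  refine ⟨D.toNNReal, fun a => ?_⟩
  rw [ENNReal.coe_toNNReal hDt]
  rcases eq_or_ne q ∞ with rfl | hqt
  · rw [logLowerBound, if_pos rfl, dyadicLowerBound, if_pos rfl]
    refine iSup_le fun n => ?_
    refine (logAverage_le (s := Nat.log 2 (n + 1) + 1) (by omega)
      (Nat.pow_log_le_self 2 (by omega)) (Nat.lt_pow_succ_log_self (by norm_num) _).le a).trans ?_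
    exact mul_le_mul_right (le_iSup (dyadicSup 2 a) _) _
  · have hr : 0 < q.toReal := ENNReal.toReal_pos hq.ne' hqt
    rw [logLowerBound, if_neg hqt, dyadicLowerBound, if_neg hqt]
    have h := tsum_inv_mul_le (u := fun n => logAverage a (n + 1) ^ q.toReal)
      (v := fun s => D ^ q.toReal * dyadicSup 2 a (s + 1) ^ q.toReal) fun s n h1 h2 => by
        rw [← ENNReal.mul_rpow_of_nonneg _ _ hr.le]
        exact ENNReal.rpow_le_rpow (logAverage_le (by omega) h1 h2.le a) hr.le
    rw [ENNReal.tsum_mul_left] at h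
    have h' : ∑' k, dyadicSup 2 a (k + 1) ^ q.toReal ≤ ∑' k, dyadicSup 2 a k ^ q.toReal := by
      rw [tsum_eq_zero_add' (f := fun k => dyadicSup 2 a k ^ q.toReal) ENNReal.summable]
      exact le_add_self
    refine (ENNReal.rpow_le_rpow (h.trans (mul_le_mul_right h' _)) (by positivity)).trans
      (le_of_eq ?_)
    rw [ENNReal.mul_rpow_of_nonneg _ _ (by positivity), one_div, ENNReal.rpow_rpow_inv hr.ne']

end HerzBochkarev

/-! ### Assembly of the three estimates -/

open HerzBochkarev
theorem theorem1p6 (q : ℝ≥0∞) (hq : 2 < q) :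
    -- the estimate in `L_{2,q,τ}`
    (∀ τ : ℝ≥0∞, 0 < τ → ∀ M : ℝ, ∃ C : ℝ≥0,
      ∀ φ : ℕ → Lp ℂ 2 unitMeasure, Orthonormal ℂ φ →
      (∀ k, ∀ᵐ x ∂unitMeasure, ‖φ k x‖ ≤ M) →
      ∀ f : ℝ → ℂ, AEStronglyMeasurable f unitMeasure → lorentzNorm₃ 2 q τ f < ∞ →
        (∀ k, Integrable (fun x => f x * conj (φ k x)) unitMeasure) ∧
        lambdaNorm 2 q τ (coeff φ f) ≤ C * lorentzNorm₃ 2 q τ f) ∧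
    -- the case `τ = q`
    (∀ M : ℝ, ∃ C : ℝ≥0,
      ∀ φ : ℕ → Lp ℂ 2 unitMeasure, Orthonormal ℂ φ →
      (∀ k, ∀ᵐ x ∂unitMeasure, ‖φ k x‖ ≤ M) →
      ∀ f : ℝ → ℂ, AEStronglyMeasurable f unitMeasure → lorentzNorm 2 q f < ∞ →
        (∀ k, Integrable (fun x => f x * conj (φ k x)) unitMeasure) ∧
        dyadicLowerBound q (coeff φ f) ≤ C * lorentzNorm 2 q f) ∧
    -- this lower bound dominates the logarithmic one
    (∃ C : ℝ≥0, ∀ a : ℕ → ℂ, logLowerBound q a ≤ C * dyadicLowerBound q a) := by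
  have hq0 : 0 < q := lt_trans (by norm_num) hq
  refine ⟨fun τ hτ M => exists_lambdaNorm_coeff_le hq hτ M, fun M => ?_,
    exists_logLowerBound_le hq0⟩
  obtain ⟨C₁, hC₁⟩ := exists_lambdaNorm_coeff_le hq hq0 M
  obtain ⟨C₂, hC₂⟩ := exists_lorentzNorm₃_self_le hq0
  obtain ⟨C₃, hC₃⟩ := exists_dyadicLowerBound_le hq0
  refine ⟨C₃ * (C₁ * C₂), fun φ hφ hM f hf hfin => ?_⟩
  obtain ⟨hint, hle⟩ := hC₁ φ hφ hM f hf
    ((hC₂ f).trans_lt (ENNReal.mul_lt_top ENNReal.coe_lt_top hfin))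
  refine ⟨hint, (hC₃ _).trans ?_⟩
  push_cast
  rw [mul_assoc, mul_assoc]
  exact mul_le_mul_right (hle.trans (mul_le_mul_right (hC₂ f) _)) _
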